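/- Let $L>0$, $\mathcal O=[0,L]$, $\mathcal H=L^2(\mathcal O)$ (real-valued, with scalar product $\langle\cdot,\cdot\rangle$), and let $g:\mathcal O\to\mathbb R$ be Hölder continuous of some order in $(\tfrac12,1]$ and positive almost everywhere. Let $A=\Delta-g$ be the Schrödinger operator on $\mathcal H$ with domain $H^2(\mathcal O)\cap H^1_0(\mathcal O)$, and let $(e_j)_{j\ge1}$ be an orthonormal basis of $\mathcal H$ consisting of eigenfunctions of $A$, $Ae_j=-\lambda_je_j$, with $\lambda_1\le\lambda_2\le\cdots$; $e_j(x)$ denotes the value at $x$ of the continuous representative of $e_j$. Let $e_j'(x)=\sqrt{2/L}\,\sin(\pi jx/L)$ and $\lambda_j'=(\pi j/L)^2$. Let $Q$ be a bounded linear operator on $\mathcal H$ that has an orthonormal basis of eigenfunctions $(b_j)_{j\ge1}$, $Qb_j=q_jb_j$, such that $q_j>0$ for all $j$, there is $D$ with $b_j=e_j'$ for all $j>D$, and $\sum_jq_j(\lambda_j')^\gamma<\infty$ for some $\gamma>-1$. Let $\sigma>0$, let $\alpha<\lambda_1$, let $(S(t))_{t\ge0}=(\mathrm e^{A_\alpha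 t})_{t\ge0}$ be the $C_0$-contraction semigroup on $\mathcal H$ generated by $A_\alpha=A+\alpha$, and let $$V(t)f=\sigma^2\int_0^tS(s)\,Q\,S(s)^*f\,\mathrm ds\qquad(f\in\mathcal H,\ t\ge0).$$ Then these integrals exist, and $V(t)$ converges strongly, as $t\to\infty$, to a bounded linear operator $V_\infty$ on $\mathcal H$. For every $x_0\in(0,L)$ and $f_\varepsilon=\varepsilon^{-1}\chi_{[x_0-\varepsilon/2,\,x_0+\varepsilon/2]}\big|_{\mathcal O}$, $$\lim_{\varepsilon\downarrow0}\langle V_\infty f_\varepsilon,f_\varepsilon\rangle=\sigma^2\sum_{j_1=1}^\infty\sum_{j_2=1}^\infty\frac{e_{j_1}(x_0)\,e_{j_2}(x_0)}{\lambda_{j_1}+\lambda_{j_2}-2\alpha}\left(\sum_{n=1}^\infty q_n\langle e_{j_1},b_n\rangle\langle e_{j_2},b_n\rangle\right),$$ where the inner series and the double series on the right-hand side converge absolutely. -/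

import Mathlib

open MeasureTheory Set Filter Topology
open scoped InnerProductSpace NNReal ENNReal ContDiff

noncomputable section

/-- Lebesgue measure on the interval `[0, L]`. -/
abbrev intervalMeasure (L : ℝ) : Measure ℝ := volume.restrict (Icc 0 L)

/-- The real Hilbert space `L²(0, L)`. -/
abbrev L2Interval (L : ℝ) : Type := Lp ℝ 2 (intervalMeasure L)

/-- `v ∈ L²(0, L)` is the weak derivative of `u ∈ L²(0, L)` on the open interval `(0, L)`,
tested against smooth functions with compact support in `(0, L)`. -/
def HasWeakDerivOn (L : ℝ) (u v : L2Interval L) : Prop :=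
  ∀ φ : ℝ → ℝ, ContDiff ℝ ∞ φ → HasCompactSupport φ → tsupport φ ⊆ Ioo 0 L →
    ∫ x, u x * deriv φ x ∂(intervalMeasure L) = - ∫ x, v x * φ x ∂(intervalMeasure L)

/-- `U` is a representative of `u ∈ L²(0, L)` that is continuous on `[0, L]`
(its values on `[0, L]` are then determined by `u`). -/
def IsContinuousRep (L : ℝ) (u : L2Interval L) (U : ℝ → ℝ) : Prop :=
  ContinuousOn U (Icc 0 L) ∧ u =ᵐ[intervalMeasure L] U

/-- `u ∈ H¹₀(0, L)`: `u` has a weak derivative in `L²(0, L)`, and its continuous representative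
vanishes at both end points. -/
def MemH10 (L : ℝ) (u : L2Interval L) : Prop :=
  (∃ v, HasWeakDerivOn L u v) ∧ ∃ U, IsContinuousRep L u U ∧ U 0 = 0 ∧ U L = 0

/-- The graph of the Dirichlet Laplacian: `u ∈ H²(0, L) ∩ H¹₀(0, L)` and `Δ u = w`. -/
def DirichletLaplacian (L : ℝ) (u w : L2Interval L) : Prop :=
  MemH10 L u ∧ ∃ v, HasWeakDerivOn L u v ∧ HasWeakDerivOn L v w

/-- The graph of the Schrödinger operator `A = Δ - g` with domain `H²(0, L) ∩ H¹₀(0, L)`: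
`u` is in the domain and `A u = w`. -/
def SchrodingerOp (L : ℝ) (g : ℝ → ℝ) (u w : L2Interval L) : Prop :=
  ∃ z, DirichletLaplacian L u z ∧ w =ᵐ[intervalMeasure L] fun x => z x - g x * u x

/-- The graph of `A_α = A + α`, where `A = Δ - g`. -/
def ShiftedSchrodingerOp (L : ℝ) (g : ℝ → ℝ) (α : ℝ) (u w : L2Interval L) : Prop :=
  ∃ z, SchrodingerOp L g u z ∧ w = z + α • u

/-- A `C₀`-semigroup of contractions `(S t)`, `t ≥ 0` (the values for `t < 0` play no role). -/
structure IsC0ContractionSemigroup {X : Type*} [NormedAddCommGroup X] [NormedSpace ℝ X]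
    (S : ℝ → X →L[ℝ] X) : Prop where
  zero : S 0 = ContinuousLinearMap.id ℝ X
  add : ∀ s t : ℝ, 0 ≤ s → 0 ≤ t → S (s + t) = (S s).comp (S t)
  continuousOn : ∀ x : X, ContinuousOn (fun t => S t x) (Ici 0)
  contraction : ∀ t : ℝ, 0 ≤ t → ‖S t‖ ≤ 1

/-- The operator with graph `A` is the infinitesimal generator of `S`: `x` lies in the domain and
`A x = y` exactly when `(S t x - x) / t → y` as `t ↓ 0`. -/
def IsInfinitesimalGenerator {X : Type*} [NormedAddCommGroup X] [NormedSpace ℝ X]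
    (S : ℝ → X →L[ℝ] X) (A : X → X → Prop) : Prop :=
  ∀ x y : X, A x y ↔ Tendsto (fun t : ℝ => t⁻¹ • (S t x - x)) (𝓝[>] 0) (𝓝 y)

/-- The integrand `S(s) Q S(s)* f` of the covariance operator. -/
def covarianceIntegrand {X : Type*} [NormedAddCommGroup X] [InnerProductSpace ℝ X]
    [CompleteSpace X] (S : ℝ → X →L[ℝ] X) (Q : X →L[ℝ] X) (f : X) (s : ℝ) : X :=
  S s (Q ((S s).adjoint f))

/-- The covariance operator `V(t) f = σ² ∫₀ᵗ S(s) Q S(s)* f ds`. -/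
def covarianceOp {X : Type*} [NormedAddCommGroup X] [InnerProductSpace ℝ X]
    [CompleteSpace X] (S : ℝ → X →L[ℝ] X) (Q : X →L[ℝ] X) (σ t : ℝ) (f : X) : X :=
  σ ^ 2 • ∫ s in (0 : ℝ)..t, covarianceIntegrand S Q f s

/-- The normalized Dirichlet eigenfunctions of the Laplacian on `[0, L]`; the index `j` stands for
the frequency `j + 1`. -/
def laplaceEigenfunction (L : ℝ) (j : ℕ) (x : ℝ) : ℝ :=
  Real.sqrt (2 / L) * Real.sin (Real.pi * (j + 1) / L * x)

/-- The eigenvalues of `-Δ` with Dirichlet conditions; the index `j` stands for `j + 1`. -/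
def laplaceEigenvalue (L : ℝ) (j : ℕ) : ℝ := (Real.pi * (j + 1) / L) ^ 2

/-- The restriction to `[0, L]` of `ε⁻¹` times the indicator of `[x₀ - ε/2, x₀ + ε/2]`, as an
element of `L²(0, L)`. -/
def boxFunction (L x₀ ε : ℝ) : L2Interval L :=
  indicatorConstLp 2 (measurableSet_Icc : MeasurableSet (Icc (x₀ - ε / 2) (x₀ + ε / 2)))
    (measure_ne_top (intervalMeasure L) _) ε⁻¹

/-- The `(j₁, j₂)` term of the pointwise series. -/
def pointwiseTerm (L α : ℝ) (lam q : ℕ → ℝ) (e : ℕ → ℝ → ℝ)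
    (eb b : HilbertBasis ℕ ℝ (L2Interval L)) (x₀ : ℝ) (j₁ j₂ : ℕ) : ℝ :=
  e j₁ x₀ * e j₂ x₀ / (lam j₁ + lam j₂ - 2 * α) *
    ∑' n, q n * ⟪eb j₁, b n⟫_ℝ * ⟪eb j₂, b n⟫_ℝ

end

/-!
The limit exists because the matrix of `V_∞` in the eigenbasis `e_j` of the Schrödinger operator is
absolutely summable. Once that is known, the coordinates `⟨f_ε, e_j⟩` of the local averages are
bounded uniformly in `j` and `ε` and tend to `e_j(x₀)`, and dominated convergence over pairs of
indices finishes the proof (`tendsto_inner_apply_self`).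

The semigroup is diagonal, `S(t) e_j = exp(-(λ_j - α) t) e_j` (`semigroup_apply_eigenvector`), hence
self-adjoint and exponentially decaying, so that `V(t)` converges and `V_∞` has the entries
`σ² ⟨e_i, Q e_j⟩ / (λ_i + λ_j - 2α)` (`exists_limit_covarianceOp`).

Summability rests on the overlaps `a_{jn} = ⟨e_j, b_n⟩`. The inequality of the means bounds
`1 / (λ_i + λ_j - 2α)` by a multiple of `1 / (i j)`, which leaves `∑_n q_n (∑_j |a_{jn}| / j)²` to
be estimated; as `∑_n q_n / n² < ∞`, it suffices that the inner sum is `O(1 / n)`. For `n > D`,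
Green's identity gives `(λ_j - λ_n') a_{jn} = ⟨g e_j, e_n'⟩`, whose right-hand side is bounded. The
eigenvalues `λ_j` and `λ_j'` differ by at most `sup |g|` for large `j`, by a min-max argument that
uses nothing but this identity (`eigenvalue_le_add_norm`), so for large `n` the gap `|λ_j - λ_n'|`
is at least a multiple of `|j² - n²|` and `a_{jn}` decays off the diagonal fast enough
(`exists_overlap_le`, `exists_tsum_overlap_le`). The finitely many remaining `b_n`, among them those
that are not eigenfunctions of the Laplacian, need only `∑_j a_{jn}² < ∞`.

The eigenfunctions are uniformly bounded by an energy estimate (`sq_le_of_classical_solution`),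
applied to the classical solutions which the weak formulation provides
(`exists_classical_solution`).
-/

/-! ### Comparison of eigenvalues -/

section Abstract

variable {H : Type*} [NormedAddCommGroup H] [InnerProductSpace ℝ H]

/-- Any `j + 1` vectors have a nontrivial linear combination orthogonal to `j` given vectors. -/
lemma exists_combination_inner_eq_zero (u v : ℕ → H) (j : ℕ) :
    ∃ c : Fin (j + 1) → ℝ, c ≠ 0 ∧ ∀ n < j, ⟪u n, ∑ i, c i • v i⟫_ℝ = 0 := by
  let T : (Fin (j + 1) → ℝ) →ₗ[ℝ] (Fin j → ℝ) :=
    { toFun := fun c n => ⟪u n, ∑ i, c i • v i⟫_ℝ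
      map_add' := fun c d => by
        ext n; simp [add_smul, Finset.sum_add_distrib, inner_add_right]
      map_smul' := fun r c => by
        ext n; simp [mul_smul, ← Finset.smul_sum, inner_smul_right] }
  obtain ⟨c, hc, hc0⟩ := (Submodule.ne_bot_iff _).1
    (LinearMap.ker_ne_bot_of_finrank_lt (f := T) (by simp))
  exact ⟨c, hc0, fun n hn => congrFun (LinearMap.mem_ker.1 hc) ⟨n, hn⟩⟩

/-- One half of the min-max comparison of two self-adjoint operators that differ by a bounded
operator `M`. Both are seen only through their eigenvectors: the Hilbert basis `u` with
eigenvalues `κ`, and the orthonormal family `v` with eigenvalues `ν`. -/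
lemma eigenvalue_le_add_norm (u : HilbertBasis ℕ ℝ H) {v : ℕ → H} (hv : Orthonormal ℝ v)
    {κ ν : ℕ → ℝ} (hκ : Monotone κ) (hν : Monotone ν) (M : H →L[ℝ] H) (j : ℕ)
    (h : ∀ i ≤ j, ∀ n ≥ j, (κ n - ν i) * ⟪u n, v i⟫_ℝ = ⟪u n, M (v i)⟫_ℝ) :
    κ j ≤ ν j + ‖M‖ := by
  obtain ⟨c, hc0, hc⟩ := exists_combination_inner_eq_zero u v j
  set f := ∑ i, c i • v i with hf
  set F := ∑ i : Fin (j + 1), (ν i * c i) • v i with hF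
  have hv' : Orthonormal ℝ fun i : Fin (j + 1) => v i := hv.comp _ Fin.val_injective
  have hff : ⟪f, f⟫_ℝ = ∑ i, c i * c i := by
    simpa using hv'.inner_sum c c Finset.univ
  have hfF : ⟪f, F⟫_ℝ = ∑ i : Fin (j + 1), c i * (ν i * c i) := by
    simpa using hv'.inner_sum c (fun i => ν i * c i) Finset.univ
  have hpos : 0 < ⟪f, f⟫_ℝ := by
    rw [hff]
    obtain ⟨i, hi⟩ := Function.ne_iff.1 hc0
    exact Finset.sum_pos' (fun i _ => mul_self_nonneg _)
      ⟨i, Finset.mem_univ _, mul_self_pos.2 hi⟩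
  have hle : ⟪f, F⟫_ℝ ≤ ν j * ⟪f, f⟫_ℝ := by
    rw [hfF, hff, Finset.mul_sum]
    refine Finset.sum_le_sum fun i _ => ?_
    have := mul_le_mul_of_nonneg_right (hν (Nat.lt_succ_iff.1 i.2)) (mul_self_nonneg (c i))
    linarith
  have hM : ⟪f, M f⟫_ℝ ≤ ‖M‖ * ⟪f, f⟫_ℝ := by
    rw [real_inner_self_eq_norm_mul_norm]
    calc ⟪f, M f⟫_ℝ ≤ ‖f‖ * ‖M f‖ := real_inner_le_norm _ _
      _ ≤ ‖f‖ * (‖M‖ * ‖f‖) := by gcongr; exact M.le_opNorm f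
      _ = _ := by ring
  have hrel : ∀ n ≥ j, ⟪u n, F + M f⟫_ℝ = κ n * ⟪u n, f⟫_ℝ := by
    intro n hn
    rw [inner_add_right, hF, hf, map_sum, inner_sum, inner_sum, inner_sum, Finset.mul_sum,
      ← Finset.sum_add_distrib]
    refine Finset.sum_congr rfl fun i _ => ?_
    have := h i (Nat.lt_succ_iff.1 i.2) n hn
    simp only [map_smul, inner_smul_right]
    rw [← this]; ring
  have hge : κ j * ⟪f, f⟫_ℝ ≤ ⟪f, F + M f⟫_ℝ := by
    refine hasSum_le (fun n => ?_) ((u.hasSum_inner_mul_inner f f).mul_left (κ j))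
      (u.hasSum_inner_mul_inner f (F + M f))
    rcases lt_or_ge n j with hn | hn
    · rw [real_inner_comm, hc n hn]; simp
    · rw [hrel n hn, real_inner_comm f]
      have := mul_le_mul_of_nonneg_right (hκ hn) (mul_self_nonneg ⟪f, u n⟫_ℝ)
      rw [real_inner_comm] at this ⊢
      linarith
  rw [inner_add_right] at hge
  refine le_of_mul_le_mul_right ?_ hpos
  linarith

/-! ### The semigroup on an eigenbasis -/

lemma HilbertBasis.clm_ext {F : Type*} [NormedAddCommGroup F] [NormedSpace ℝ F]
    (u : HilbertBasis ℕ ℝ H) {S T : H →L[ℝ] F} (h : ∀ n, S (u n) = T (u n)) : S = T := by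
  refine ContinuousLinearMap.ext_on (s := range u) ?_ (by rintro _ ⟨n, rfl⟩; exact h n)
  exact Submodule.dense_iff_topologicalClosure_eq_top.2 u.dense_span

end Abstract

/-- An eigenvector of the generator is an eigenvector of the semigroup: `e^{μt} S(t) x` has
vanishing right derivative. -/
lemma semigroup_apply_eigenvector {X : Type*} [NormedAddCommGroup X] [NormedSpace ℝ X]
    {S : ℝ → X →L[ℝ] X} (hS : IsC0ContractionSemigroup S) {A : X → X → Prop}
    (hA : IsInfinitesimalGenerator S A) {x : X} {μ : ℝ} (hx : A x (-μ • x)) {t : ℝ}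
    (ht : 0 ≤ t) : S t x = Real.exp (-μ * t) • x := by
  have hd : ∀ s, 0 ≤ s → HasDerivWithinAt (fun s => S s x) (-μ • S s x) (Ici s) s := by
    intro s hs
    rw [← hasDerivWithinAt_Ioi_iff_Ici, hasDerivWithinAt_iff_tendsto_slope' (by simp)]
    have h1 := ((S s).continuous.tendsto _).comp ((hA x _).1 hx)
    have h2 : Tendsto (fun r : ℝ => r - s) (𝓝[>] s) (𝓝[>] 0) := by
      refine tendsto_nhdsWithin_iff.2 ⟨?_, ?_⟩
      · have : Tendsto (fun r : ℝ => r - s) (𝓝 s) (𝓝 (s - s)) :=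
          (continuous_id.sub continuous_const).tendsto s
        rw [sub_self] at this
        exact this.mono_left nhdsWithin_le_nhds
      · filter_upwards [self_mem_nhdsWithin] with r hr
        exact sub_pos.2 (mem_Ioi.1 hr)
    have h3 := h1.comp h2
    rw [map_smul] at h3
    refine h3.congr' ?_
    filter_upwards [self_mem_nhdsWithin] with r hr
    have hr' : 0 ≤ r - s := (sub_pos.2 (mem_Ioi.1 hr)).le
    have := hS.add s (r - s) hs hr'
    rw [add_sub_cancel] at this
    simp [slope_def_module, this]
  have hc : ∀ s ∈ Icc 0 t, Real.exp (μ * s) • S s x = Real.exp (μ * 0) • S 0 x := by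
    refine constant_of_has_deriv_right_zero ?_ fun s hs => ?_
    · exact ContinuousOn.smul (by fun_prop)
        ((hS.continuousOn x).mono fun s hs => hs.1)
    · have he : HasDerivWithinAt (fun s => Real.exp (μ * s)) (Real.exp (μ * s) * μ) (Ici s) s := by
        simpa using (((hasDerivAt_id s).const_mul μ).exp).hasDerivWithinAt
      have h0 : Real.exp (μ * s) • (-μ • S s x) + (Real.exp (μ * s) * μ) • S s x = 0 := by
        rw [smul_smul, ← add_smul]
        ring_nf
        simp
      rw [← h0]
      exact he.smul (hd s hs.1)
  have h := hc t ⟨ht, le_rfl⟩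
  rw [hS.zero] at h
  simp only [mul_zero, Real.exp_zero, one_smul, ContinuousLinearMap.id_apply] at h
  calc S t x = Real.exp (-μ * t) • Real.exp (μ * t) • S t x := by
        rw [smul_smul, ← Real.exp_add]; simp
    _ = _ := by rw [h]

section Diagonal

variable {H : Type*} [NormedAddCommGroup H] [InnerProductSpace ℝ H] [CompleteSpace H]

lemma adjoint_eq_self_of_diagonal (u : HilbertBasis ℕ ℝ H) {T : H →L[ℝ] H} {d : ℕ → ℝ}
    (h : ∀ n, T (u n) = d n • u n) : T.adjoint = T := by
  classical
  refine u.clm_ext fun n => u.repr.injective (lp.ext (funext fun m => ?_))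
  rw [u.repr_apply_apply, u.repr_apply_apply, ContinuousLinearMap.adjoint_inner_right, h, h,
    inner_smul_left, inner_smul_right, orthonormal_iff_ite.1 u.orthonormal]
  split_ifs with hmn
  · simp [hmn]
  · simp

lemma norm_apply_le_of_diagonal (u : HilbertBasis ℕ ℝ H) {T : H →L[ℝ] H} {d : ℕ → ℝ} {K : ℝ}
    (hK : 0 ≤ K) (h : ∀ n, T (u n) = d n • u n) (hd : ∀ n, |d n| ≤ K) (f : H) :
    ‖T f‖ ≤ K * ‖f‖ := by
  refine abs_le_of_sq_le_sq' ?_ (by positivity) |>.2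
  rw [mul_pow, ← real_inner_self_eq_norm_sq, ← real_inner_self_eq_norm_sq]
  refine hasSum_le (fun n => ?_) (u.hasSum_inner_mul_inner (T f) (T f))
    ((u.hasSum_inner_mul_inner f f).mul_left (K ^ 2))
  have h1 : ⟪u n, T f⟫_ℝ = d n * ⟪u n, f⟫_ℝ := by
    rw [← ContinuousLinearMap.adjoint_inner_left, adjoint_eq_self_of_diagonal u h, h,
      inner_smul_left]
    simp
  rw [real_inner_comm, h1, real_inner_comm (u n) f]
  have := mul_le_mul_of_nonneg_right (sq_le_sq' (abs_le.1 (hd n)).1 (abs_le.1 (hd n)).2)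
    (mul_self_nonneg ⟪u n, f⟫_ℝ)
  linarith

/-- The matrix of an operator diagonal in the basis `b`, seen from two arbitrary vectors. -/
lemma hasSum_inner_diagonal (b : HilbertBasis ℕ ℝ H) {Q : H →L[ℝ] H} {q : ℕ → ℝ}
    (hQ : ∀ n, Q (b n) = q n • b n) (x y : H) :
    HasSum (fun n => q n * ⟪x, b n⟫_ℝ * ⟪y, b n⟫_ℝ) ⟪x, Q y⟫_ℝ := by
  rw [← ContinuousLinearMap.adjoint_inner_left, adjoint_eq_self_of_diagonal b hQ]
  have e : (fun n => q n * ⟪x, b n⟫_ℝ * ⟪y, b n⟫_ℝ) = fun n => ⟪Q x, b n⟫_ℝ * ⟪b n, y⟫_ℝ := by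
    funext n
    rw [← ContinuousLinearMap.adjoint_inner_right, adjoint_eq_self_of_diagonal b hQ, hQ,
      inner_smul_right, real_inner_comm (b n) y]
  rw [e]
  exact b.hasSum_inner_mul_inner (Q x) y

end Diagonal

/-! ### The stationary covariance operator -/

lemma IsC0ContractionSemigroup.continuousOn_apply {X : Type*} [NormedAddCommGroup X]
    [NormedSpace ℝ X] {S : ℝ → X →L[ℝ] X} (hS : IsC0ContractionSemigroup S) {y : ℝ → X}
    (hy : ContinuousOn y (Ici 0)) : ContinuousOn (fun s => S s (y s)) (Ici 0) := by
  intro s₀ hs₀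
  rw [ContinuousWithinAt, tendsto_iff_norm_sub_tendsto_zero]
  have h1 := tendsto_iff_norm_sub_tendsto_zero.1 (hy s₀ hs₀)
  have h2 := tendsto_iff_norm_sub_tendsto_zero.1 (hS.continuousOn (y s₀) s₀ hs₀)
  have h3 := h1.add h2
  rw [add_zero] at h3
  refine squeeze_zero' (Eventually.of_forall fun _ => norm_nonneg _) ?_ h3
  filter_upwards [self_mem_nhdsWithin] with s hs
  calc ‖S s (y s) - S s₀ (y s₀)‖ = ‖S s (y s - y s₀) + (S s (y s₀) - S s₀ (y s₀))‖ := by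
        rw [map_sub]; congr 1; abel
    _ ≤ ‖S s (y s - y s₀)‖ + ‖S s (y s₀) - S s₀ (y s₀)‖ := norm_add_le _ _
    _ ≤ _ := by
        gcongr
        exact (S s).le_of_opNorm_le (hS.contraction s hs) _ |>.trans_eq (one_mul _)

section Covariance

variable {H : Type*} [NormedAddCommGroup H] [InnerProductSpace ℝ H] [CompleteSpace H]
  {S : ℝ → H →L[ℝ] H} {u : HilbertBasis ℕ ℝ H} {μ : ℕ → ℝ}

lemma covarianceIntegrand_eq_of_diagonal (Q : H →L[ℝ] H)
    (hu : ∀ t, 0 ≤ t → ∀ n, S t (u n) = Real.exp (-μ n * t) • u n)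
    (f : H) {s : ℝ} (hs : 0 ≤ s) : covarianceIntegrand S Q f s = S s (Q (S s f)) := by
  rw [covarianceIntegrand, adjoint_eq_self_of_diagonal u (hu s hs)]

lemma continuousOn_covarianceIntegrand (hS : IsC0ContractionSemigroup S)
    (Q : H →L[ℝ] H) (hu : ∀ t, 0 ≤ t → ∀ n, S t (u n) = Real.exp (-μ n * t) • u n) (f : H) :
    ContinuousOn (covarianceIntegrand S Q f) (Ici 0) :=
  (hS.continuousOn_apply (Q.continuous.comp_continuousOn (hS.continuousOn f))).congr
    fun _ hs => covarianceIntegrand_eq_of_diagonal Q hu f hs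

lemma norm_covarianceIntegrand_le
    (Q : H →L[ℝ] H) (hu : ∀ t, 0 ≤ t → ∀ n, S t (u n) = Real.exp (-μ n * t) • u n)
    (hμ : Monotone μ) (f : H) {s : ℝ} (hs : 0 ≤ s) :
    ‖covarianceIntegrand S Q f s‖ ≤ ‖Q‖ * ‖f‖ * Real.exp (-(2 * μ 0) * s) := by
  have hb : ∀ x, ‖S s x‖ ≤ Real.exp (-μ 0 * s) * ‖x‖ := by
    refine norm_apply_le_of_diagonal u (Real.exp_nonneg _) (hu s hs) fun n => ?_
    rw [abs_of_nonneg (Real.exp_nonneg _), Real.exp_le_exp]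
    exact mul_le_mul_of_nonneg_right (neg_le_neg (hμ (Nat.zero_le n))) hs
  rw [covarianceIntegrand_eq_of_diagonal Q hu f hs]
  calc ‖S s (Q (S s f))‖ ≤ Real.exp (-μ 0 * s) * (‖Q‖ * (Real.exp (-μ 0 * s) * ‖f‖)) :=
        (hb _).trans (by
          gcongr
          exact (Q.le_opNorm _).trans (by gcongr; exact hb f))
    _ = ‖Q‖ * ‖f‖ * (Real.exp (-μ 0 * s) * Real.exp (-μ 0 * s)) := by ring
    _ = _ := by rw [← Real.exp_add]; ring_nf

lemma integrableOn_covarianceIntegrand (hS : IsC0ContractionSemigroup S)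
    (Q : H →L[ℝ] H) (hu : ∀ t, 0 ≤ t → ∀ n, S t (u n) = Real.exp (-μ n * t) • u n)
    (hμ : Monotone μ) (hμ0 : 0 < μ 0) (f : H) :
    IntegrableOn (covarianceIntegrand S Q f) (Ioi 0) := by
  refine Integrable.mono' ((exp_neg_integrableOn_Ioi 0 (b := 2 * μ 0) (by positivity)).const_mul
    (‖Q‖ * ‖f‖)) ?_ ?_
  · exact ((continuousOn_covarianceIntegrand hS Q hu f).mono
      Ioi_subset_Ici_self).aestronglyMeasurable measurableSet_Ioi
  · filter_upwards [ae_restrict_mem measurableSet_Ioi] with s hs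
    exact norm_covarianceIntegrand_le Q hu hμ f (le_of_lt hs)

/-- The covariance operators converge strongly, since the semigroup decays exponentially, and
the matrix of the limit in the eigenbasis is found by integrating `e^{-(μᵢ + μⱼ)s}`. -/
lemma exists_limit_covarianceOp (hS : IsC0ContractionSemigroup S)
    (Q : H →L[ℝ] H) (hu : ∀ t, 0 ≤ t → ∀ n, S t (u n) = Real.exp (-μ n * t) • u n)
    (hμ : Monotone μ) (hμ0 : 0 < μ 0) (σ : ℝ) :
    ∃ V : H →L[ℝ] H, (∀ f, Tendsto (fun t => covarianceOp S Q σ t f) atTop (𝓝 (V f))) ∧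
      ∀ i j, ⟪u i, V (u j)⟫_ℝ = σ ^ 2 * (⟪u i, Q (u j)⟫_ℝ / (μ i + μ j)) := by
  have hint := integrableOn_covarianceIntegrand hS Q hu hμ hμ0
  let W : H →ₗ[ℝ] H :=
    { toFun := fun f => ∫ s in Ioi (0 : ℝ), covarianceIntegrand S Q f s
      map_add' := fun f f' => by
        rw [← integral_add (hint f) (hint f')]
        simp [covarianceIntegrand]
      map_smul' := fun c f => by
        rw [RingHom.id_apply, ← integral_smul]
        simp [covarianceIntegrand] }
  have hW : ∀ f, ‖W f‖ ≤ (‖Q‖ * ∫ s in Ioi (0 : ℝ), Real.exp (-(2 * μ 0) * s)) * ‖f‖ := by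
    intro f
    calc ‖W f‖ ≤ ∫ s in Ioi (0 : ℝ), ‖Q‖ * ‖f‖ * Real.exp (-(2 * μ 0) * s) := by
          refine norm_integral_le_of_norm_le
            ((exp_neg_integrableOn_Ioi 0 (by positivity)).const_mul _) ?_
          filter_upwards [ae_restrict_mem measurableSet_Ioi] with s hs
          exact norm_covarianceIntegrand_le Q hu hμ f (le_of_lt hs)
      _ = _ := by rw [integral_const_mul]; ring
  refine ⟨σ ^ 2 • W.mkContinuous _ hW, fun f => ?_, fun i j => ?_⟩
  · exact (intervalIntegral_tendsto_integral_Ioi 0 (hint f) tendsto_id).const_smul (σ ^ 2)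
  · have hpos : 0 < μ i + μ j :=
      add_pos (hμ0.trans_le (hμ (Nat.zero_le i))) (hμ0.trans_le (hμ (Nat.zero_le j)))
    have h1 : ⟪u i, W (u j)⟫_ℝ
        = ∫ s in Ioi (0 : ℝ), ⟪u i, Q (u j)⟫_ℝ * Real.exp (-(μ i + μ j) * s) := by
      change ⟪u i, ∫ s in Ioi (0 : ℝ), covarianceIntegrand S Q (u j) s⟫_ℝ = _
      rw [← integral_inner (hint (u j))]
      refine setIntegral_congr_fun measurableSet_Ioi fun s hs => ?_
      have hs' : 0 ≤ s := le_of_lt hs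
      rw [covarianceIntegrand_eq_of_diagonal Q hu _ hs', ← ContinuousLinearMap.adjoint_inner_left,
        adjoint_eq_self_of_diagonal u (hu s hs'), hu s hs', hu s hs', map_smul, inner_smul_left,
        inner_smul_right, neg_add, add_mul, Real.exp_add]
      simp only [conj_trivial]
      ring
    rw [integral_const_mul, integral_exp_mul_Ioi (neg_neg_of_pos hpos)] at h1
    change ⟪u i, σ ^ 2 • W (u j)⟫_ℝ = _
    rw [inner_smul_right, h1, neg_div_neg_eq, mul_zero, Real.exp_zero, mul_one_div]

end Covariance

section QuadraticForm

variable {H : Type*} [NormedAddCommGroup H] [InnerProductSpace ℝ H] [CompleteSpace H]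

/-- A quadratic form is the sum of its matrix against the coordinates, as soon as this double
series converges absolutely. -/
lemma inner_apply_self_eq_tsum (u : HilbertBasis ℕ ℝ H) (V : H →L[ℝ] H) (f : H)
    (h : Summable fun p : ℕ × ℕ => ⟪f, u p.1⟫_ℝ * ⟪f, u p.2⟫_ℝ * ⟪u p.1, V (u p.2)⟫_ℝ) :
    ⟪V f, f⟫_ℝ = ∑' p : ℕ × ℕ, ⟪f, u p.1⟫_ℝ * ⟪f, u p.2⟫_ℝ * ⟪u p.1, V (u p.2)⟫_ℝ := by
  rw [h.tsum_prod, real_inner_comm, ← (u.hasSum_inner_mul_inner f (V f)).tsum_eq]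
  refine tsum_congr fun i => ?_
  rw [← ContinuousLinearMap.adjoint_inner_left, real_inner_comm f (V.adjoint (u i)),
    ← (u.hasSum_inner_mul_inner f (V.adjoint (u i))).tsum_eq, ← tsum_mul_left]
  refine tsum_congr fun j => ?_
  rw [ContinuousLinearMap.adjoint_inner_right, real_inner_comm (V (u j))]
  ring

/-- If the matrix of `V` is absolutely summable and the coordinates of `f` are uniformly bounded
along a filter and converge, then the quadratic form of `V` at `f` converges to the matrix applied
to the limiting coordinates, although `f` itself need not converge. -/
lemma tendsto_inner_apply_self {ι : Type*} {l : Filter ι} (u : HilbertBasis ℕ ℝ H)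
    (V : H →L[ℝ] H) (hV : Summable fun p : ℕ × ℕ => |⟪u p.1, V (u p.2)⟫_ℝ|) {f : ι → H}
    {c : ℕ → ℝ} {K : ℝ} (hc : ∀ n, Tendsto (fun i => ⟪f i, u n⟫_ℝ) l (𝓝 (c n)))
    (hK : ∀ᶠ i in l, ∀ n, |⟪f i, u n⟫_ℝ| ≤ K) :
    Tendsto (fun i => ⟪V (f i), f i⟫_ℝ) l
      (𝓝 (∑' p : ℕ × ℕ, c p.1 * c p.2 * ⟪u p.1, V (u p.2)⟫_ℝ)) := by
  have hbd : ∀ᶠ i in l, ∀ p : ℕ × ℕ, ‖⟪f i, u p.1⟫_ℝ * ⟪f i, u p.2⟫_ℝ * ⟪u p.1, V (u p.2)⟫_ℝ‖ ≤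
      K * K * |⟪u p.1, V (u p.2)⟫_ℝ| := by
    filter_upwards [hK] with i hi p
    have hK0 : 0 ≤ K := (abs_nonneg _).trans (hi 0)
    rw [Real.norm_eq_abs, abs_mul, abs_mul]
    gcongr
    · exact hi _
    · exact hi _
  refine (tendsto_tsum_of_dominated_convergence (hV.mul_left (K * K))
    (fun p => ((hc p.1).mul (hc p.2)).mul_const _) hbd).congr' ?_
  filter_upwards [hbd] with i hi
  exact (inner_apply_self_eq_tsum u V (f i)
    (Summable.of_norm_bounded (hV.mul_left (K * K)) hi)).symm

end QuadraticForm

/-! ### Summability of the double series -/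

section Summability

variable {lam : ℕ → ℝ} {c G : ℝ} {D : ℕ} {a : ℕ → ℕ → ℝ}

/-- The eigenvalues `lam j` stay within `G` of `c (j + 1)²`, whose gaps grow linearly, so that
the commutator identity for the overlaps `a j n` forces decay away from the diagonal. -/
lemma exists_overlap_le (hc : 0 < c)
    (h1 : ∀ j, lam j ≤ c * (j + 1) ^ 2 + G) (h2 : ∀ j ≥ D, c * (j + 1) ^ 2 ≤ lam j + G)
    (h3 : ∀ j, ∀ n ≥ D, |(lam j - c * (n + 1) ^ 2) * a j n| ≤ G) :
    ∃ N : ℕ, ∀ n ≥ N, ∀ j, j ≠ n →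
      |a j n| ≤ 2 * G / c / (n + 1) * |((j : ℤ) - n : ℝ)|⁻¹ := by
  obtain ⟨N, hN⟩ := exists_nat_ge (2 * G / c)
  refine ⟨max D N, fun n hn j hj => ?_⟩
  have hnD : D ≤ n := (le_max_left _ _).trans hn
  have hnN : (N : ℝ) ≤ n := by exact_mod_cast (le_max_right _ _).trans hn
  have hG2 : 2 * G ≤ c * (n + 1) := by
    have := (div_le_iff₀ hc).1 hN
    nlinarith
  have hn0 : (0 : ℝ) ≤ n := n.cast_nonneg
  have hj0 : (0 : ℝ) ≤ j := j.cast_nonneg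
  set d : ℝ := |((j : ℤ) - n : ℝ)| with hd
  have hd1 : 1 ≤ d := by
    have : (1 : ℤ) ≤ |(j : ℤ) - n| := Int.one_le_abs (by omega)
    rw [hd]; exact_mod_cast this
  have hgap : c * (n + 1) * d ≤ 2 * |lam j - c * (n + 1) ^ 2| := by
    rcases lt_or_gt_of_ne hj with h | h
    · have hjn : (j : ℝ) + 1 ≤ n := by exact_mod_cast h
      have hde : d = n - j := by
        rw [hd, abs_sub_comm, abs_of_nonneg] <;> push_cast <;> linarith
      have hle : c * (n + 1) * d ≤ c * (n + 1) ^ 2 - c * (j + 1) ^ 2 := by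
        have : c * (n + 1) ^ 2 - c * (j + 1) ^ 2 = c * (n + 1) * d + c * (d * (j + 1)) := by
          rw [hde]; ring
        have : 0 ≤ c * (d * (j + 1)) := by positivity
        linarith
      have hlow : 2 * G ≤ c * (n + 1) * d := hG2.trans (le_mul_of_one_le_right (by positivity) hd1)
      have := neg_le_abs (lam j - c * (n + 1) ^ 2)
      have := h1 j
      linarith
    · have hjn : (n : ℝ) + 1 ≤ j := by exact_mod_cast h
      have hde : d = j - n := by
        rw [hd, abs_of_nonneg] <;> push_cast <;> linarith
      have hle : c * (n + 1) * d ≤ c * (j + 1) ^ 2 - c * (n + 1) ^ 2 := by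
        have : c * (j + 1) ^ 2 - c * (n + 1) ^ 2 = c * (n + 1) * d + c * (d * (j + 1)) := by
          rw [hde]; ring
        have : 0 ≤ c * (d * (j + 1)) := by positivity
        linarith
      have hlow : 2 * G ≤ c * (n + 1) * d := hG2.trans (le_mul_of_one_le_right (by positivity) hd1)
      have := le_abs_self (lam j - c * (n + 1) ^ 2)
      have := h2 j (hnD.trans h.le)
      linarith
  have h4 := h3 j n hnD
  rw [abs_mul] at h4
  rw [div_div, ← div_eq_mul_inv, div_div, le_div_iff₀ (by positivity)]
  have := mul_le_mul_of_nonneg_right hgap (abs_nonneg (a j n))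
  linarith

/-- The shifted eigenvalues grow at least quadratically, with a constant valid for all indices. -/
lemma exists_mul_sq_le_sub {α : ℝ} (hc : 0 < c) (hlam : Monotone lam) (hα : α < lam 0)
    (h2 : ∀ j ≥ D, c * (j + 1) ^ 2 ≤ lam j + G) :
    ∃ k > 0, ∀ j : ℕ, k * (j + 1) ^ 2 ≤ lam j - α := by
  obtain ⟨N, hN⟩ := exists_nat_ge (2 * (G + α) / c)
  set m := max D N
  refine ⟨min (c / 2) ((lam 0 - α) / (m + 1) ^ 2),
    lt_min (by positivity) (div_pos (sub_pos.2 hα) (by positivity)), fun j => ?_⟩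
  have hj0 : (0 : ℝ) ≤ j := j.cast_nonneg
  rcases le_or_gt m j with h | h
  · have hNj : (N : ℝ) ≤ j := by exact_mod_cast (le_max_right _ _).trans h
    have h5 : 2 * (G + α) ≤ c * (j + 1) ^ 2 := by
      have := (div_le_iff₀ hc).1 hN
      nlinarith [mul_nonneg hc.le (mul_nonneg hj0 hj0), mul_le_mul_of_nonneg_left hNj hc.le,
        mul_nonneg hc.le hj0]
    have h6 := h2 j ((le_max_left _ _).trans h)
    calc _ ≤ c / 2 * ((j : ℝ) + 1) ^ 2 := by gcongr; exact min_le_left _ _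
      _ ≤ _ := by linarith
  · have hjm : (j : ℝ) + 1 ≤ m + 1 := by
      have : (j : ℝ) ≤ m := by exact_mod_cast h.le
      linarith
    have h0 := sub_pos.2 hα
    calc _ ≤ (lam 0 - α) / (m + 1) ^ 2 * ((m : ℝ) + 1) ^ 2 := by
          gcongr; exact min_le_right _ _
      _ = lam 0 - α := div_mul_cancel₀ _ (by positivity)
      _ ≤ _ := by have := hlam (Nat.zero_le j); linarith

lemma summable_one_div_succ_sq : Summable fun j : ℕ => 1 / ((j : ℝ) + 1) ^ 2 := by
  have := (summable_nat_add_iff 1).2 (Real.summable_one_div_nat_pow.2 one_lt_two)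
  simpa using this

lemma summable_div_succ {x : ℕ → ℝ} (hx : Summable fun j => x j ^ 2) :
    Summable fun j : ℕ => |x j| / ((j : ℝ) + 1) := by
  refine Summable.of_nonneg_of_le (fun j => by positivity) (fun j => ?_)
    (hx.add summable_one_div_succ_sq)
  have h := two_mul_le_add_sq |x j| (1 / ((j : ℝ) + 1))
  have h0 : 0 ≤ |x j| * (1 / ((j : ℝ) + 1)) := by positivity
  rw [sq_abs, div_pow, one_pow] at h
  rw [div_eq_mul_one_div]
  linarith

/-- The weighted column sums of the overlap matrix inherit the decay `1 / (n + 1)` of its diagonal: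
for large `n` the off-diagonal part is summed by `|xy| ≤ x² + y²`. -/
lemma exists_tsum_overlap_le {K : ℝ} (hK : 0 ≤ K) {N : ℕ} (ha1 : ∀ j n, |a j n| ≤ 1)
    (ha2 : ∀ n, Summable fun j => a j n ^ 2)
    (ha : ∀ n ≥ N, ∀ j, j ≠ n → |a j n| ≤ K / (n + 1) * |((j : ℤ) - n : ℝ)|⁻¹) :
    ∃ C, 0 ≤ C ∧ ∀ n : ℕ, ∑' j : ℕ, |a j n| / ((j : ℝ) + 1) ≤ C / (n + 1) := by
  set Z := ∑' k : ℤ, 1 / (k : ℝ) ^ 2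
  set Z' := ∑' j : ℕ, 1 / ((j : ℝ) + 1) ^ 2
  have hZs : Summable fun k : ℤ => 1 / (k : ℝ) ^ 2 := Real.summable_one_div_int_pow.2 one_lt_two
  set C₁ := ∑ n ∈ Finset.range N, (∑' j : ℕ, |a j n| / ((j : ℝ) + 1)) * (n + 1)
  have hA0 : ∀ n, 0 ≤ ∑' j : ℕ, |a j n| / ((j : ℝ) + 1) := fun n =>
    tsum_nonneg fun j => by positivity
  have hC₁ : 0 ≤ C₁ := Finset.sum_nonneg fun n _ => mul_nonneg (hA0 n) (by positivity)
  have hZ : 0 ≤ Z := tsum_nonneg fun k => by positivity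
  have hZ' : 0 ≤ Z' := tsum_nonneg fun k => by positivity
  have hC₂ : 0 ≤ 1 + K * (Z + Z') := by positivity
  refine ⟨C₁ + (1 + K * (Z + Z')), by positivity, fun n => ?_⟩
  have hn : (0 : ℝ) < n + 1 := by positivity
  rw [le_div_iff₀ hn]
  rcases lt_or_ge n N with h | h
  -- the finitely many columns `n < N` are absorbed into the constant
  · have := Finset.single_le_sum
      (f := fun n : ℕ => (∑' j : ℕ, |a j n| / ((j : ℝ) + 1)) * ((n : ℝ) + 1))
      (fun n _ => mul_nonneg (hA0 n) (by positivity)) (Finset.mem_range.2 h)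
    linarith
  · have hinj : Function.Injective fun j : ℕ => (j : ℤ) - n := fun i j hij => by
      simpa using hij
    have hs1 : Summable fun j : ℕ => if j = n then 1 / ((n : ℝ) + 1) else 0 :=
      (hasSum_ite_eq n _).summable
    have hs2 : Summable fun j : ℕ => 1 / (((j : ℤ) - n : ℤ) : ℝ) ^ 2 := hZs.comp_injective hinj
    have hs3 := (hs2.add summable_one_div_succ_sq).mul_left (K / (n + 1))
    have hle : ∑' j : ℕ, |a j n| / ((j : ℝ) + 1) ≤
        1 / ((n : ℝ) + 1) + K / (n + 1) * (Z + Z') := by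
      calc ∑' j : ℕ, |a j n| / ((j : ℝ) + 1)
          ≤ ∑' j : ℕ, ((if j = n then 1 / ((n : ℝ) + 1) else 0) + K / (n + 1) *
            (1 / (((j : ℤ) - n : ℤ) : ℝ) ^ 2 + 1 / ((j : ℝ) + 1) ^ 2)) := by
            refine (summable_div_succ (ha2 n)).tsum_le_tsum (fun j => ?_) (hs1.add hs3)
            by_cases hj : j = n
            · rw [if_pos hj, hj]
              have : 0 ≤ K / ((n : ℝ) + 1) *
                (1 / (((n : ℤ) - n : ℤ) : ℝ) ^ 2 + 1 / ((n : ℝ) + 1) ^ 2) := by positivity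
              have : |a n n| / ((n : ℝ) + 1) ≤ 1 / ((n : ℝ) + 1) := by
                gcongr; exact ha1 n n
              linarith
            · rw [if_neg hj, zero_add]
              set x : ℝ := |((j : ℤ) - n : ℝ)|⁻¹ with hx
              set y : ℝ := 1 / ((j : ℝ) + 1) with hy
              have hxy : x * y ≤ x ^ 2 + y ^ 2 := by
                nlinarith [sq_nonneg (x - y), sq_nonneg x, sq_nonneg y]
              have hx2 : 1 / (((j : ℤ) - n : ℤ) : ℝ) ^ 2 = x ^ 2 := by
                rw [hx, inv_pow, sq_abs, one_div]; push_cast; rfl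
              have hy2 : 1 / ((j : ℝ) + 1) ^ 2 = y ^ 2 := by rw [hy, div_pow, one_pow]
              rw [hx2, hy2, div_eq_mul_one_div]
              calc |a j n| * y ≤ K / (n + 1) * x * y := by
                    gcongr; exact ha n h j hj
                _ = K / (n + 1) * (x * y) := by ring
                _ ≤ _ := by gcongr
        _ = 1 / ((n : ℝ) + 1) + K / (n + 1) *
            (∑' j : ℕ, 1 / (((j : ℤ) - n : ℤ) : ℝ) ^ 2 + Z') := by
            rw [hs1.tsum_add hs3, tsum_ite_eq, tsum_mul_left, hs2.tsum_add summable_one_div_succ_sq]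
        _ ≤ _ := by
            gcongr
            exact tsum_comp_le_tsum_of_inj hZs (fun k => by positivity) hinj
    have := mul_le_mul_of_nonneg_right hle hn.le
    have e : (1 / ((n : ℝ) + 1) + K / (n + 1) * (Z + Z')) * (n + 1) = 1 + K * (Z + Z') := by
      field_simp
    linarith

/-- Absolute convergence of the double series. By the inequality of the means
`1 / (μ i + μ j)` is dominated by the product `1 / ((i + 1) (j + 1))`, so that the sum over `(i, j)`
for fixed `n` factors into the square of a weighted column sum. -/
lemma summable_abs_tsum_div {q μ : ℕ → ℝ} {k C : ℝ} (hq : ∀ n, 0 ≤ q n)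
    (hqs : Summable fun n : ℕ => q n / ((n : ℝ) + 1) ^ 2) (hk : 0 < k)
    (hμ : ∀ j : ℕ, k * (j + 1) ^ 2 ≤ μ j)
    (ha2 : ∀ n, Summable fun j => a j n ^ 2) (hC : 0 ≤ C)
    (hA : ∀ n : ℕ, ∑' j : ℕ, |a j n| / ((j : ℝ) + 1) ≤ C / (n + 1))
    (hs : ∀ i j, Summable fun n => |q n * a i n * a j n|) :
    Summable fun p : ℕ × ℕ => |(∑' n, q n * a p.1 n * a p.2 n) / (μ p.1 + μ p.2)| := by
  set A : ℕ → ℝ := fun n => ∑' j : ℕ, |a j n| / ((j : ℝ) + 1)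
  have hA0 : ∀ n, 0 ≤ A n := fun n => tsum_nonneg fun j => by positivity
  set w : ℕ → ℕ × ℕ → ℝ := fun n p =>
    q n * (|a p.1 n| / ((p.1 : ℝ) + 1) * (|a p.2 n| / ((p.2 : ℝ) + 1))) with hw
  have hw0 : ∀ n p, 0 ≤ w n p := fun n p => mul_nonneg (hq n) (by positivity)
  have hws : ∀ n, Summable fun p : ℕ × ℕ =>
      |a p.1 n| / ((p.1 : ℝ) + 1) * (|a p.2 n| / ((p.2 : ℝ) + 1)) := fun n =>
    (summable_div_succ (ha2 n)).mul_of_nonneg (summable_div_succ (ha2 n))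
      (fun j => by positivity) (fun j => by positivity)
  have hwt : ∀ n, ∑' p, w n p = q n * (A n * A n) := fun n => by
    have h : A n * A n = ∑' p : ℕ × ℕ,
        |a p.1 n| / ((p.1 : ℝ) + 1) * (|a p.2 n| / ((p.2 : ℝ) + 1)) :=
      Summable.tsum_mul_tsum (f := fun j : ℕ => |a j n| / ((j : ℝ) + 1))
        (g := fun j : ℕ => |a j n| / ((j : ℝ) + 1)) (summable_div_succ (ha2 n))
        (summable_div_succ (ha2 n)) (hws n)
    rw [h, ← tsum_mul_left]
  have hsum : Summable fun x : ℕ × (ℕ × ℕ) => w x.1 x.2 := by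
    have hwn : ∀ n, Summable (w n) := fun n => (hws n).mul_left (q n)
    have hw0' : 0 ≤ fun x : ℕ × (ℕ × ℕ) => w x.1 x.2 := fun x => hw0 x.1 x.2
    refine (summable_prod_of_nonneg hw0').2 ⟨hwn, ?_⟩
    refine Summable.of_nonneg_of_le (fun n => tsum_nonneg (hw0 n)) (fun n => ?_)
      (hqs.mul_left (C * C))
    rw [hwt]
    calc q n * (A n * A n) ≤ q n * (C / (n + 1) * (C / (n + 1))) := by
          have := hq n
          have := hA0 n
          gcongr <;> exact hA n
      _ = C * C * (q n / (n + 1) ^ 2) := by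
          rw [div_mul_div_comm, ← pow_two ((n : ℝ) + 1)]; ring
  have hswap : Summable fun x : (ℕ × ℕ) × ℕ => w x.2 x.1 := hsum.prod_symm
  have hcol : Summable fun p : ℕ × ℕ => ∑' n, w n p := hswap.prod
  replace hcol := hcol.mul_left (1 / (2 * k))
  refine Summable.of_nonneg_of_le (fun p => abs_nonneg _) (fun p => ?_) hcol
  have hden : 2 * k * ((p.1 + 1) * (p.2 + 1)) ≤ μ p.1 + μ p.2 := by
    have h1 := hμ p.1
    have h2 := hμ p.2
    have := mul_nonneg hk.le (sq_nonneg ((p.1 : ℝ) - p.2))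
    linarith
  have hden0 : 0 < 2 * k * (((p.1 : ℝ) + 1) * (p.2 + 1)) := by positivity
  have hnum : |∑' n, q n * a p.1 n * a p.2 n| ≤ ∑' n, |q n * a p.1 n * a p.2 n| := by
    have h : Summable fun n => ‖q n * a p.1 n * a p.2 n‖ := hs p.1 p.2
    exact norm_tsum_le_tsum_norm h
  rw [abs_div, abs_of_pos (hden0.trans_le hden)]
  calc |∑' n, q n * a p.1 n * a p.2 n| / (μ p.1 + μ p.2)
      ≤ (∑' n, |q n * a p.1 n * a p.2 n|) / (2 * k * (((p.1 : ℝ) + 1) * (p.2 + 1))) := by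
        gcongr
    _ = 1 / (2 * k) * ∑' n, w n p := by
        rw [div_eq_mul_inv, ← tsum_mul_right, ← tsum_mul_left]
        refine tsum_congr fun n => ?_
        rw [hw, abs_mul, abs_mul, abs_of_nonneg (hq n)]
        field_simp

end Summability

/-! ### Regularity of eigenfunctions -/

lemma integral_intervalMeasure {L : ℝ} (hL : 0 < L) (f : ℝ → ℝ) :
    ∫ x, f x ∂(intervalMeasure L) = ∫ x in (0 : ℝ)..L, f x := by
  rw [intervalIntegral.integral_of_le hL.le, integral_Icc_eq_integral_Ioc]

lemma integral_intervalMeasure_of_tsupport_subset {L : ℝ} {ψ : ℝ → ℝ}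
    (h : tsupport ψ ⊆ Ioo 0 L) : ∫ x, ψ x ∂(intervalMeasure L) = ∫ x, ψ x := by
  refine setIntegral_eq_integral_of_forall_compl_eq_zero fun x hx => ?_
  by_contra h0
  exact hx (Ioo_subset_Icc_self (h (subset_tsupport ψ h0)))

/-- A smooth function with compact support in `(0, L)` and vanishing integral is the derivative of
another such function. -/
lemma exists_deriv_eq_of_integral_eq_zero {L : ℝ} {η : ℝ → ℝ} (h1 : ContDiff ℝ ∞ η)
    (h2 : HasCompactSupport η) (h3 : tsupport η ⊆ Ioo 0 L) (h4 : ∫ x, η x = 0) :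
    ∃ φ : ℝ → ℝ, ContDiff ℝ ∞ φ ∧ HasCompactSupport φ ∧ tsupport φ ⊆ Ioo 0 L ∧ deriv φ = η := by
  have hd : ∀ x, HasDerivAt (fun x => ∫ t in (0 : ℝ)..x, η t) (η x) x := fun x =>
    (h1.continuous.integral_hasStrictDerivAt 0 x).hasDerivAt
  have hde : deriv (fun x => ∫ t in (0 : ℝ)..x, η t) = η := funext fun x => (hd x).deriv
  rcases (tsupport η).eq_empty_or_nonempty with he | hne
  · refine ⟨0, contDiff_const, HasCompactSupport.zero, by simp [tsupport], ?_⟩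
    rw [tsupport_eq_empty_iff.1 he]
    ext x; simp
  obtain ⟨a, ha, hamin⟩ := h2.isCompact.exists_isLeast hne
  obtain ⟨b, hb, hbmax⟩ := h2.isCompact.exists_isGreatest hne
  have hsub : Function.support (fun x => ∫ t in (0 : ℝ)..x, η t) ⊆ Icc a b := by
    intro x hx
    by_contra hxab
    refine hx ?_
    rcases lt_or_ge x a with hxa | hxa
    · refine (intervalIntegral.integral_congr (g := fun _ => (0 : ℝ)) fun t ht => ?_).trans
        (by simp)
      refine image_eq_zero_of_notMem_tsupport fun htt => ?_
      have := hamin htt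
      have h0a := (h3 ha).1
      rcases ht with ⟨_, ht⟩
      exact absurd (this.trans ht) (not_le.2 (max_lt h0a hxa))
    · have hbx : b < x := by
        by_contra hbx
        exact hxab ⟨hxa, not_lt.1 hbx⟩
      refine (intervalIntegral.integral_eq_integral_of_support_subset fun t ht => ?_).trans h4
      have ht' := subset_tsupport η ht
      exact ⟨(h3 ht').1, (hbmax ht').trans hbx.le⟩
  refine ⟨fun x => ∫ t in (0 : ℝ)..x, η t, ?_,
    HasCompactSupport.of_support_subset_isCompact isCompact_Icc hsub,
    (closure_minimal hsub isClosed_Icc).trans (Icc_subset_Ioo (h3 ha).1 (h3 hb).2), hde⟩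
  rw [contDiff_infty_iff_deriv, hde]
  exact ⟨fun x => (hd x).differentiableAt, h1⟩

lemma exists_bump {L : ℝ} (hL : 0 < L) :
    ∃ ρ : ℝ → ℝ, ContDiff ℝ ∞ ρ ∧ HasCompactSupport ρ ∧ tsupport ρ ⊆ Ioo 0 L ∧ ∫ x, ρ x = 1 := by
  let B : ContDiffBump (L / 2) := ⟨L / 8, L / 4, by positivity, by linarith⟩
  refine ⟨B.normed volume, B.contDiff_normed, B.hasCompactSupport_normed, ?_, B.integral_normed⟩
  rw [B.tsupport_normed_eq, Real.closedBall_eq_Icc]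
  refine Icc_subset_Ioo ?_ ?_ <;> simp only [B] <;> linarith

lemma Integrable.mul_of_hasCompactSupport {μ : Measure ℝ} {h φ : ℝ → ℝ} (hh : Integrable h μ)
    (h1 : Continuous φ) (h2 : HasCompactSupport φ) : Integrable (fun x => h x * φ x) μ := by
  obtain ⟨C, hC⟩ := h1.bounded_above_of_compact_support h2
  exact hh.mul_bdd (c := C) h1.aestronglyMeasurable (Eventually.of_forall hC)

/-- The lemma of du Bois-Reymond: a function with vanishing weak derivative is constant. -/
lemma ae_eq_const_of_integral_mul_deriv_eq_zero {L : ℝ} (hL : 0 < L) {h : ℝ → ℝ}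
    (hh : Integrable h (intervalMeasure L))
    (h0 : ∀ φ : ℝ → ℝ, ContDiff ℝ ∞ φ → HasCompactSupport φ → tsupport φ ⊆ Ioo 0 L →
      ∫ x, h x * deriv φ x ∂(intervalMeasure L) = 0) :
    ∃ c : ℝ, h =ᵐ[intervalMeasure L] fun _ => c := by
  obtain ⟨ρ, r1, r2, r3, r4⟩ := exists_bump hL
  set c := ∫ x, h x * ρ x ∂(intervalMeasure L) with hc
  refine ⟨c, ?_⟩
  have key : ∀ᵐ x ∂(intervalMeasure L), x ∈ Ioo 0 L → h x - c = 0 := by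
    refine isOpen_Ioo.ae_eq_zero_of_integral_contDiff_smul_eq_zero
      ((hh.sub (integrable_const c)).locallyIntegrable.locallyIntegrableOn _)
      fun ψ p1 p2 p3 => ?_
    set m := ∫ x, ψ x with hm
    -- `ψ - m ρ` has mean zero, hence is the derivative of a test function
    have e3 : tsupport (fun x => ψ x - m * ρ x) ⊆ Ioo 0 L := by
      refine (tsupport_sub ψ fun x => m * ρ x).trans (union_subset p3 ?_)
      exact (closure_mono (Function.support_const_smul_subset m ρ)).trans r3
    have e2 : HasCompactSupport (fun x => ψ x - m * ρ x) := p2.sub (r2.mul_left (f := fun _ => m))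
    obtain ⟨φ, f1, f2, f3, f4⟩ := exists_deriv_eq_of_integral_eq_zero
      (p1.sub (contDiff_const.mul r1)) e2 e3 (by
        rw [integral_sub (p1.continuous.integrable_of_hasCompactSupport p2)
          ((r1.continuous.integrable_of_hasCompactSupport r2).const_mul m), integral_const_mul, r4,
          mul_one, sub_self])
    have i1 := Integrable.mul_of_hasCompactSupport hh p1.continuous p2
    have i2 := Integrable.mul_of_hasCompactSupport hh r1.continuous r2
    have i3 := Integrable.mul_of_hasCompactSupport (integrable_const (μ := intervalMeasure L) c)
      p1.continuous p2
    have h5 := h0 φ f1 f2 f3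
    have e5 : ∀ x, h x * deriv φ x = h x * ψ x - m * (h x * ρ x) := fun x => by
      rw [f4]; ring
    simp only [e5] at h5
    rw [integral_sub i1 (i2.const_mul m), integral_const_mul, ← hc] at h5
    have e6 : ∀ x, ψ x • (h x - c) = h x * ψ x - c * ψ x := fun x => by
      rw [smul_eq_mul]; ring
    simp only [e6]
    rw [integral_sub i1 i3, integral_const_mul, integral_intervalMeasure_of_tsupport_subset p3,
      ← hm]
    linarith
  have hIoo : ∀ᵐ x ∂(intervalMeasure L), x ∈ Ioo 0 L := by
    rw [intervalMeasure, ← restrict_Ioo_eq_restrict_Icc]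
    exact ae_restrict_mem measurableSet_Ioo
  filter_upwards [key, hIoo] with x hx hx'
  exact sub_eq_zero.1 (hx hx')

lemma L2Interval.integrable {L : ℝ} (u : L2Interval L) : Integrable u (intervalMeasure L) :=
  (Lp.memLp u).integrable one_le_two

/-- A function whose weak derivative is continuous is a primitive of it. -/
lemma HasWeakDerivOn.ae_eq_integral {L : ℝ} (hL : 0 < L) {u v : L2Interval L}
    (h : HasWeakDerivOn L u v) {V : ℝ → ℝ} (hV : Continuous V) (hvV : v =ᵐ[intervalMeasure L] V) :
    ∃ c : ℝ, u =ᵐ[intervalMeasure L] fun x => c + ∫ t in (0 : ℝ)..x, V t := by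
  have hP : ∀ x, HasDerivAt (fun x => ∫ t in (0 : ℝ)..x, V t) (V x) x := fun x =>
    (hV.integral_hasStrictDerivAt 0 x).hasDerivAt
  have hPc : Continuous fun x => ∫ t in (0 : ℝ)..x, V t :=
    continuous_iff_continuousAt.2 fun x => (hP x).continuousAt
  have hPi : Integrable (fun x => ∫ t in (0 : ℝ)..x, V t) (intervalMeasure L) :=
    hPc.continuousOn.integrableOn_compact isCompact_Icc
  obtain ⟨c, hc⟩ := ae_eq_const_of_integral_mul_deriv_eq_zero hL (u.integrable.sub hPi)
    fun φ f1 f2 f3 => by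
      have hφ0 : ∀ x, x ∉ Ioo 0 L → φ x = 0 := fun x hx =>
        image_eq_zero_of_notMem_tsupport fun h' => hx (f3 h')
      have hφd : Continuous (deriv φ) := f1.continuous_deriv (by simp)
      have i1 := Integrable.mul_of_hasCompactSupport u.integrable hφd f2.deriv
      have i2 := Integrable.mul_of_hasCompactSupport hPi hφd f2.deriv
      have e1 : ∫ x, (∫ t in (0 : ℝ)..x, V t) * deriv φ x ∂(intervalMeasure L) =
          -∫ x, v x * φ x ∂(intervalMeasure L) := by
        have e2 : ∫ x, v x * φ x ∂(intervalMeasure L) = ∫ x, V x * φ x ∂(intervalMeasure L) :=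
          integral_congr_ae (by filter_upwards [hvV] with x hx; rw [hx])
        rw [e2, integral_intervalMeasure hL, integral_intervalMeasure hL,
          intervalIntegral.integral_mul_deriv_eq_deriv_mul (fun x _ => hP x)
          (fun x _ => ((f1.differentiable (by simp)) x).hasDerivAt)
          (hV.intervalIntegrable _ _) (hφd.intervalIntegrable _ _), hφ0 0 (by simp),
          hφ0 L (by simp)]
        simp
      simp only [Pi.sub_apply, sub_mul]
      rw [integral_sub i1 i2, h φ f1 f2 f3, e1, sub_self]
  refine ⟨c, ?_⟩
  filter_upwards [hc] with x hx
  simp only [Pi.sub_apply] at hx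
  linarith

lemma IsContinuousRep.eqOn {L : ℝ} (hL : 0 < L) {u : L2Interval L} {U U' : ℝ → ℝ}
    (h : IsContinuousRep L u U) (h' : IsContinuousRep L u U') : EqOn U U' (Icc 0 L) :=
  Measure.eqOn_Icc_of_ae_eq volume hL.ne (h.2.symm.trans h'.2) h.1 h'.1

/-- The continuous representative of an eigenfunction of `Δ - g` is a classical solution of the
Dirichlet problem. -/
lemma exists_classical_solution {L : ℝ} (hL : 0 < L) {g : ℝ → ℝ} (hg : ContinuousOn g (Icc 0 L))
    {u : L2Interval L} {lam : ℝ} (hu : SchrodingerOp L g u (-lam • u)) {e : ℝ → ℝ}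
    (he : IsContinuousRep L u e) :
    ∃ U V : ℝ → ℝ, EqOn e U (Icc 0 L) ∧ (∀ x, HasDerivAt U (V x) x) ∧
      (∀ x ∈ Icc 0 L, HasDerivAt V ((g x - lam) * U x) x) ∧ U 0 = 0 ∧ U L = 0 := by
  obtain ⟨z, ⟨⟨-, U₀, hU₀, h00, h0L⟩, v, huv, hvz⟩, hz⟩ := hu
  have heU := he.eqOn hL hU₀
  set W : ℝ → ℝ := IccExtend hL.le ((Icc 0 L).domRestrict fun x => (g x - lam) * e x) with hW
  have hWc : Continuous W :=
    (continuousOn_iff_continuous_domRestrict.1 ((hg.sub continuousOn_const).mul he.1)).Icc_extend'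
  have hWx : ∀ x ∈ Icc 0 L, W x = (g x - lam) * e x := fun x hx => by
    rw [hW, IccExtend_of_mem _ _ hx]; rfl
  have hzW : z =ᵐ[intervalMeasure L] W := by
    filter_upwards [hz, he.2, Lp.coeFn_smul (-lam) u, ae_restrict_mem measurableSet_Icc]
      with x h1 h2 h3 h4
    rw [hWx x h4]
    rw [h3, Pi.smul_apply, smul_eq_mul, h2] at h1
    linarith
  obtain ⟨c, hc⟩ := hvz.ae_eq_integral hL hWc hzW
  set V : ℝ → ℝ := fun x => c + ∫ t in (0 : ℝ)..x, W t with hV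
  have hVd : ∀ x, HasDerivAt V (W x) x := fun x =>
    (hWc.integral_hasStrictDerivAt 0 x).hasDerivAt.const_add c
  have hVc : Continuous V := continuous_iff_continuousAt.2 fun x => (hVd x).continuousAt
  obtain ⟨c', hc'⟩ := huv.ae_eq_integral hL hVc hc
  set U : ℝ → ℝ := fun x => c' + ∫ t in (0 : ℝ)..x, V t with hU
  have hUd : ∀ x, HasDerivAt U (V x) x := fun x =>
    (hVc.integral_hasStrictDerivAt 0 x).hasDerivAt.const_add c'
  have hUc : Continuous U := continuous_iff_continuousAt.2 fun x => (hUd x).continuousAt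
  have heq : EqOn e U (Icc 0 L) := he.eqOn hL ⟨hUc.continuousOn, hc'⟩
  have m0 : (0 : ℝ) ∈ Icc 0 L := ⟨le_rfl, hL.le⟩
  have mL : L ∈ Icc 0 L := ⟨hL.le, le_rfl⟩
  refine ⟨U, V, heq, hUd, fun x hx => ?_, ?_, ?_⟩
  · rw [← heq hx, ← hWx x hx]; exact hVd x
  · rw [← heq m0, heU m0, h00]
  · rw [← heq mL, heU mL, h0L]

/-! ### Estimates for classical eigenfunctions -/

section Classical

variable {L lam G : ℝ} {g U V : ℝ → ℝ}

/-- The energy `V² + lam U²` of a solution satisfies a differential inequality, and therefore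
varies at most by a factor independent of the eigenvalue. -/
lemma energy_le (hG : ∀ x ∈ Icc 0 L, |g x| ≤ G) (hlam : 1 ≤ lam)
    (hU : ∀ x, HasDerivAt U (V x) x)
    (hV : ∀ x ∈ Icc 0 L, HasDerivAt V ((g x - lam) * U x) x) {x y : ℝ} (hx : x ∈ Icc 0 L)
    (hy : y ∈ Icc 0 L) :
    V x ^ 2 + lam * U x ^ 2 ≤ Real.exp (G * L) * (V y ^ 2 + lam * U y ^ 2) := by
  have hG0 : 0 ≤ G := (abs_nonneg _).trans (hG x hx)
  set E : ℝ → ℝ := fun x => V x ^ 2 + lam * U x ^ 2 with hE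
  have hE0 : ∀ x, 0 ≤ E x := fun x => by positivity
  have hEd : ∀ x ∈ Icc 0 L, HasDerivAt E (2 * g x * U x * V x) x := fun x hx => by
    refine (((hV x hx).pow 2).add (((hU x).pow 2).const_mul lam)).congr_deriv ?_
    simp only [Nat.cast_ofNat, Nat.add_one_sub_one, pow_one]
    ring
  have hbd : ∀ x ∈ Icc 0 L, |2 * g x * U x * V x| ≤ G * E x := fun x hx => by
    have h1 : 2 * (|U x| * |V x|) ≤ E x := by
      have := two_mul_le_add_sq |U x| |V x|
      rw [sq_abs, sq_abs] at this
      have h2 : U x ^ 2 ≤ lam * U x ^ 2 := le_mul_of_one_le_left (sq_nonneg _) hlam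
      simp only [hE]
      linarith
    calc |2 * g x * U x * V x| = |g x| * (2 * (|U x| * |V x|)) := by
          rw [abs_mul, abs_mul, abs_mul, abs_two]; ring
      _ ≤ G * E x := mul_le_mul (hG x hx) h1 (by positivity) hG0
  have hexp : ∀ k x : ℝ, HasDerivAt (fun x => Real.exp (k * x)) (Real.exp (k * x) * k) x :=
    fun k x => by simpa using ((hasDerivAt_id x).const_mul k).exp
  have hd : ∀ k, ∀ x ∈ Icc 0 L, HasDerivAt (fun x => E x * Real.exp (k * x))
      ((2 * g x * U x * V x + k * E x) * Real.exp (k * x)) x := fun k x hx => by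
    refine ((hEd x hx).mul (hexp k x)).congr_deriv ?_
    ring
  -- `E e^{-Gx}` decreases and `E e^{Gx}` increases
  rcases le_total y x with hyx | hxy
  · have hanti : AntitoneOn (fun x => E x * Real.exp (-G * x)) (Icc 0 L) := by
      refine antitoneOn_of_deriv_nonpos (convex_Icc 0 L)
        (fun x hx => (hd _ x hx).continuousAt.continuousWithinAt)
        (fun x hx => (hd _ x (interior_subset hx)).differentiableAt.differentiableWithinAt)
        fun x hx => ?_
      rw [(hd _ x (interior_subset hx)).deriv]
      have := (abs_le.1 (hbd x (interior_subset hx))).2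
      exact mul_nonpos_of_nonpos_of_nonneg (by linarith) (Real.exp_nonneg _)
    have h := hanti hy hx hyx
    calc E x = E x * Real.exp (-G * x) * Real.exp (G * x) := by
          rw [mul_assoc, ← Real.exp_add]; simp
      _ ≤ E y * Real.exp (-G * y) * Real.exp (G * x) := by gcongr
      _ = Real.exp (G * (x - y)) * E y := by rw [mul_assoc, ← Real.exp_add]; ring_nf
      _ ≤ _ := by
          have := hE0 y
          gcongr
          linarith [hx.2, hy.1]
  · have hmono : MonotoneOn (fun x => E x * Real.exp (G * x)) (Icc 0 L) := by
      refine monotoneOn_of_deriv_nonneg (convex_Icc 0 L)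
        (fun x hx => (hd _ x hx).continuousAt.continuousWithinAt)
        (fun x hx => (hd _ x (interior_subset hx)).differentiableAt.differentiableWithinAt)
        fun x hx => ?_
      rw [(hd _ x (interior_subset hx)).deriv]
      have := (abs_le.1 (hbd x (interior_subset hx))).1
      exact mul_nonneg (by linarith) (Real.exp_nonneg _)
    have h := hmono hx hy hxy
    calc E x = E x * Real.exp (G * x) * Real.exp (-G * x) := by
          rw [mul_assoc, ← Real.exp_add]; simp
      _ ≤ E y * Real.exp (G * y) * Real.exp (-G * x) := by gcongr
      _ = Real.exp (G * (y - x)) * E y := by rw [mul_assoc, ← Real.exp_add]; ring_nf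
      _ ≤ _ := by
          have := hE0 y
          gcongr
          linarith [hx.1, hy.2]

/-- Normalized eigenfunctions are bounded uniformly in the eigenvalue: the mean of the energy is
at most `(2 lam + G) / L`, and the energy dominates `lam U²`. -/
lemma sq_le_of_classical_solution (hL : 0 < L) (hg : ContinuousOn g (Icc 0 L))
    (hG : ∀ x ∈ Icc 0 L, |g x| ≤ G) (hlam : 1 ≤ lam) (hU : ∀ x, HasDerivAt U (V x) x)
    (hV : ∀ x ∈ Icc 0 L, HasDerivAt V ((g x - lam) * U x) x) (h0 : U 0 = 0) (h1 : U L = 0)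
    (hnorm : ∫ x in (0 : ℝ)..L, U x * U x = 1) {x : ℝ} (hx : x ∈ Icc 0 L) :
    U x ^ 2 ≤ Real.exp (G * L) * (2 + G) / L := by
  have hI : uIcc 0 L = Icc 0 L := uIcc_of_le hL.le
  have hG0 : 0 ≤ G := (abs_nonneg _).trans (hG x hx)
  have cU : ContinuousOn U (uIcc 0 L) := fun x _ => (hU x).continuousAt.continuousWithinAt
  have cV : ContinuousOn V (uIcc 0 L) := fun x hx =>
    (hV x (hI ▸ hx)).continuousAt.continuousWithinAt
  have cg : ContinuousOn g (uIcc 0 L) := hI ▸ hg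
  have iUU : IntervalIntegrable (fun x => U x * U x) volume 0 L := (cU.mul cU).intervalIntegrable
  have iVV : IntervalIntegrable (fun x => V x * V x) volume 0 L := (cV.mul cV).intervalIntegrable
  have iW : IntervalIntegrable (fun x => (g x - lam) * U x) volume 0 L :=
    ((cg.sub continuousOn_const).mul cU).intervalIntegrable
  have iUW : IntervalIntegrable (fun x => U x * ((g x - lam) * U x)) volume 0 L :=
    (cU.mul ((cg.sub continuousOn_const).mul cU)).intervalIntegrable
  have hparts := intervalIntegral.integral_mul_deriv_eq_deriv_mul (fun x _ => hU x)
    (fun x hx => hV x (hI ▸ hx)) cV.intervalIntegrable iW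
  rw [h0, h1, zero_mul, zero_mul, sub_zero, zero_sub] at hparts
  have hVV : ∫ x in (0 : ℝ)..L, V x * V x ≤ lam + G := by
    have e : ∫ x in (0 : ℝ)..L, V x * V x = ∫ x in (0 : ℝ)..L, -(U x * ((g x - lam) * U x)) := by
      rw [intervalIntegral.integral_neg, hparts, neg_neg]
    rw [e]
    calc _ ≤ ∫ x in (0 : ℝ)..L, (lam + G) * (U x * U x) := by
          refine intervalIntegral.integral_mono_on hL.le iUW.neg (iUU.const_mul _) fun t ht => ?_
          have := mul_le_mul_of_nonneg_right (abs_le.1 (hG t ht)).1 (mul_self_nonneg (U t))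
          linarith
      _ = lam + G := by rw [intervalIntegral.integral_const_mul, hnorm, mul_one]
  have hE : (V x ^ 2 + lam * U x ^ 2) * L ≤ Real.exp (G * L) * ((2 + G) * lam) := by
    calc (V x ^ 2 + lam * U x ^ 2) * L = ∫ _ in (0 : ℝ)..L, (V x ^ 2 + lam * U x ^ 2) := by
          rw [intervalIntegral.integral_const]; simp [mul_comm]
      _ ≤ ∫ y in (0 : ℝ)..L, Real.exp (G * L) * (V y * V y + lam * (U y * U y)) := by
          refine intervalIntegral.integral_mono_on hL.le intervalIntegrable_const
            ((iVV.add (iUU.const_mul _)).const_mul _) fun t ht => ?_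
          have := energy_le hG hlam hU hV hx ht
          rwa [pow_two (V t), pow_two (U t)] at this
      _ = Real.exp (G * L) * ((∫ y in (0 : ℝ)..L, V y * V y) + lam) := by
          rw [intervalIntegral.integral_const_mul,
            intervalIntegral.integral_add iVV (iUU.const_mul _),
            intervalIntegral.integral_const_mul, hnorm, mul_one]
      _ ≤ _ := by
          gcongr
          nlinarith
  rw [le_div_iff₀ hL]
  have hlam0 : 0 < lam := zero_lt_one.trans_le hlam
  refine le_of_mul_le_mul_right ?_ hlam0
  have : 0 ≤ V x ^ 2 * L := by positivity
  linarith

/-- Green's identity against an eigenfunction of the Laplacian. -/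
lemma integral_potential_mul (hL : 0 < L) (hg : ContinuousOn g (Icc 0 L))
    (hU : ∀ x, HasDerivAt U (V x) x)
    (hV : ∀ x ∈ Icc 0 L, HasDerivAt V ((g x - lam) * U x) x) (h0 : U 0 = 0) (h1 : U L = 0)
    {φ ψ : ℝ → ℝ} {ν : ℝ} (hφ : ∀ x, HasDerivAt φ (ψ x) x)
    (hψ : ∀ x, HasDerivAt ψ (-ν * φ x) x) (hφ0 : φ 0 = 0) (hφ1 : φ L = 0) :
    ∫ x in (0 : ℝ)..L, g x * U x * φ x = (lam - ν) * ∫ x in (0 : ℝ)..L, U x * φ x := by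
  have hI : uIcc 0 L = Icc 0 L := uIcc_of_le hL.le
  have cU : ContinuousOn U (uIcc 0 L) := fun x _ => (hU x).continuousAt.continuousWithinAt
  have cφ : ContinuousOn φ (uIcc 0 L) := fun x _ => (hφ x).continuousAt.continuousWithinAt
  have cg : ContinuousOn g (uIcc 0 L) := hI ▸ hg
  have i1 : IntervalIntegrable (fun x => g x * U x * φ x) volume 0 L :=
    ((cg.mul cU).mul cφ).intervalIntegrable
  have i2 : IntervalIntegrable (fun x => (lam - ν) * (U x * φ x)) volume 0 L :=
    ((cU.mul cφ).intervalIntegrable).const_mul _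
  have h := intervalIntegral.integral_eq_sub_of_hasDerivAt (a := 0) (b := L)
    (f := fun x => V x * φ x - U x * ψ x)
    (f' := fun x => g x * U x * φ x - (lam - ν) * (U x * φ x))
    (fun x hx => by
      refine (((hV x (hI ▸ hx)).mul (hφ x)).sub ((hU x).mul (hψ x))).congr_deriv ?_
      ring) (i1.sub i2)
  rw [intervalIntegral.integral_sub i1 i2, intervalIntegral.integral_const_mul, h0, h1, hφ0,
    hφ1] at h
  linarith

end Classical

/-! ### The eigenfunctions of the Laplacian -/

lemma laplaceEigenfunction_continuous (L : ℝ) (n : ℕ) : Continuous (laplaceEigenfunction L n) := by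
  unfold laplaceEigenfunction; fun_prop

lemma memLp_of_continuous (L : ℝ) {φ : ℝ → ℝ} (h : Continuous φ) :
    MemLp φ 2 (intervalMeasure L) := by
  obtain ⟨C, hC⟩ := isCompact_Icc.exists_bound_of_continuousOn (s := Icc 0 L) h.continuousOn
  exact MemLp.of_bound h.aestronglyMeasurable C
    ((ae_restrict_mem measurableSet_Icc).mono fun x hx => hC x hx)

/-- The Dirichlet eigenfunction of the Laplacian as an element of `L²(0, L)`. -/
noncomputable def laplaceEigenvector (L : ℝ) (n : ℕ) : L2Interval L :=
  (memLp_of_continuous L (laplaceEigenfunction_continuous L n)).toLp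

lemma laplaceEigenvector_ae_eq (L : ℝ) (n : ℕ) :
    laplaceEigenvector L n =ᵐ[intervalMeasure L] laplaceEigenfunction L n :=
  MemLp.coeFn_toLp _

lemma L2Interval.inner_eq {L : ℝ} (hL : 0 < L) {u v : L2Interval L} {U V : ℝ → ℝ}
    (hu : u =ᵐ[intervalMeasure L] U) (hv : v =ᵐ[intervalMeasure L] V) :
    ⟪u, v⟫_ℝ = ∫ x in (0 : ℝ)..L, U x * V x := by
  rw [L2.inner_def, ← integral_intervalMeasure hL]
  refine integral_congr_ae ?_
  filter_upwards [hu, hv] with x h1 h2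
  rw [h1, h2]
  simp [mul_comm]

lemma integral_cos_int_mul {L : ℝ} (hL : 0 < L) (k : ℤ) :
    ∫ x in (0 : ℝ)..L, Real.cos (Real.pi * k / L * x) = if k = 0 then L else 0 := by
  split_ifs with hk
  · simp [hk]
  · have hk' : Real.pi * k / L ≠ 0 :=
      div_ne_zero (mul_ne_zero Real.pi_ne_zero (Int.cast_ne_zero.2 hk)) hL.ne'
    rw [intervalIntegral.integral_comp_mul_left Real.cos hk', integral_cos, mul_zero,
      Real.sin_zero, div_mul_cancel₀ _ hL.ne', mul_comm, Real.sin_int_mul_pi]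
    simp

lemma laplaceEigenvector_orthonormal {L : ℝ} (hL : 0 < L) :
    Orthonormal ℝ (laplaceEigenvector L) := by
  classical
  refine orthonormal_iff_ite.2 fun m n => ?_
  rw [L2Interval.inner_eq hL (laplaceEigenvector_ae_eq L m) (laplaceEigenvector_ae_eq L n)]
  have e : ∀ x, laplaceEigenfunction L m x * laplaceEigenfunction L n x =
      1 / L * (Real.cos (Real.pi * ((m : ℤ) - n : ℤ) / L * x) -
        Real.cos (Real.pi * ((m : ℤ) + n + 2 : ℤ) / L * x)) := fun x => by
    have h1 : Real.pi * ((m : ℤ) - n : ℤ) / L * x =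
        Real.pi * (m + 1) / L * x - Real.pi * (n + 1) / L * x := by push_cast; ring
    have h2 : Real.pi * ((m : ℤ) + n + 2 : ℤ) / L * x =
        Real.pi * (m + 1) / L * x + Real.pi * (n + 1) / L * x := by push_cast; ring
    have hs : Real.sqrt (2 / L) * Real.sqrt (2 / L) = 2 / L :=
      Real.mul_self_sqrt (by positivity)
    rw [h1, h2, Real.cos_sub, Real.cos_add, laplaceEigenfunction, laplaceEigenfunction]
    calc _ = Real.sqrt (2 / L) * Real.sqrt (2 / L) * (Real.sin (Real.pi * (m + 1) / L * x) *
          Real.sin (Real.pi * (n + 1) / L * x)) := by ring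
      _ = _ := by rw [hs]; ring
  simp only [e]
  rw [intervalIntegral.integral_const_mul, intervalIntegral.integral_sub
    (Continuous.intervalIntegrable (by fun_prop) _ _)
    (Continuous.intervalIntegrable (by fun_prop) _ _), integral_cos_int_mul hL,
    integral_cos_int_mul hL, if_neg (by omega : ¬ ((m : ℤ) + n + 2 = 0))]
  by_cases h : m = n
  · rw [if_pos h, if_pos (by omega)]; field_simp; ring
  · rw [if_neg h, if_neg (by omega)]; simp

/-! ### Multiplication by the potential -/

/-- Multiplication by a bounded continuous function, as a bounded operator on `L²(0, L)`. -/
lemma exists_mul_clm {L G : ℝ} {g : ℝ → ℝ} (hg : ContinuousOn g (Icc 0 L))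
    (hG : ∀ x ∈ Icc 0 L, |g x| ≤ G) (hG0 : 0 ≤ G) :
    ∃ M : L2Interval L →L[ℝ] L2Interval L, ‖M‖ ≤ G ∧
      ∀ u : L2Interval L, M u =ᵐ[intervalMeasure L] fun x => g x * u x := by
  have hb : ∀ u : L2Interval L, ∀ᵐ x ∂(intervalMeasure L), ‖g x * u x‖ ≤ G * ‖u x‖ := fun u =>
    (ae_restrict_mem measurableSet_Icc).mono fun x hx => by
      rw [norm_mul]
      exact mul_le_mul_of_nonneg_right (hG x hx) (norm_nonneg _)
  have hm : ∀ u : L2Interval L, MemLp (fun x => g x * u x) 2 (intervalMeasure L) := fun u =>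
    (Lp.memLp u).of_le_mul
      ((hg.aestronglyMeasurable measurableSet_Icc).mul (Lp.aestronglyMeasurable u)) (hb u)
  let T : L2Interval L →ₗ[ℝ] L2Interval L :=
    { toFun := fun u => (hm u).toLp
      map_add' := fun u v => by
        refine Lp.ext ?_
        filter_upwards [(hm (u + v)).coeFn_toLp, (hm u).coeFn_toLp, (hm v).coeFn_toLp,
          Lp.coeFn_add u v, Lp.coeFn_add (hm u).toLp (hm v).toLp] with x h1 h2 h3 h4 h5
        rw [h1, h5, Pi.add_apply, h2, h3, h4, Pi.add_apply, mul_add]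
      map_smul' := fun c u => by
        refine Lp.ext ?_
        filter_upwards [(hm (c • u)).coeFn_toLp, (hm u).coeFn_toLp,
          Lp.coeFn_smul c u, Lp.coeFn_smul c (hm u).toLp] with x h1 h2 h3 h4
        rw [h1, RingHom.id_apply, h4, Pi.smul_apply, h2, h3, Pi.smul_apply, smul_eq_mul,
          smul_eq_mul]
        ring }
  have hT : ∀ u, T u =ᵐ[intervalMeasure L] fun x => g x * u x := fun u => (hm u).coeFn_toLp
  have hTn : ∀ u, ‖T u‖ ≤ G * ‖u‖ := fun u => by
    refine Lp.norm_le_mul_norm_of_ae_le_mul ?_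
    filter_upwards [hT u, hb u] with x h1 h2
    rw [h1]; exact h2
  exact ⟨T.mkContinuous G hTn, LinearMap.mkContinuous_norm_le _ hG0 _, hT⟩

/-! ### Eigenvalues and eigenfunctions of the Schrödinger operator -/

section Schrodinger

variable {L G : ℝ} {g : ℝ → ℝ} {lam : ℕ → ℝ} {eb b : HilbertBasis ℕ ℝ (L2Interval L)}
  {e : ℕ → ℝ → ℝ} {D : ℕ}

lemma laplaceEigenvalue_eq (L : ℝ) (n : ℕ) :
    laplaceEigenvalue L n = (Real.pi / L) ^ 2 * (n + 1) ^ 2 := by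
  rw [laplaceEigenvalue]; ring

lemma laplaceEigenvalue_monotone (L : ℝ) : Monotone (laplaceEigenvalue L) := fun m n h => by
  rw [laplaceEigenvalue_eq, laplaceEigenvalue_eq]
  gcongr

/-- The commutator identity between the Schrödinger operator and the Laplacian, in terms of their
eigenvectors. -/
lemma inner_mul_laplaceEigenvector (hL : 0 < L) (hg : ContinuousOn g (Icc 0 L))
    {M : L2Interval L →L[ℝ] L2Interval L}
    (hM : ∀ u : L2Interval L, M u =ᵐ[intervalMeasure L] fun x => g x * u x)
    {u : L2Interval L} {l : ℝ} (hu : SchrodingerOp L g u (-l • u)) {f : ℝ → ℝ}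
    (hf : IsContinuousRep L u f) (n : ℕ) :
    ⟪M u, laplaceEigenvector L n⟫_ℝ =
      (l - laplaceEigenvalue L n) * ⟪u, laplaceEigenvector L n⟫_ℝ := by
  obtain ⟨U, V, hfU, hU, hV, h0, h1⟩ := exists_classical_solution hL hg hu hf
  have huU : u =ᵐ[intervalMeasure L] U := by
    filter_upwards [hf.2, ae_restrict_mem measurableSet_Icc] with x hx hx'
    rw [hx, hfU hx']
  have hMU : M u =ᵐ[intervalMeasure L] fun x => g x * U x := by
    filter_upwards [hM u, huU] with x h2 h3
    rw [h2, h3]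
  rw [L2Interval.inner_eq hL hMU (laplaceEigenvector_ae_eq L n),
    L2Interval.inner_eq hL huU (laplaceEigenvector_ae_eq L n)]
  set k := Real.pi * (n + 1) / L with hk
  have hlin : ∀ x, HasDerivAt (fun x => k * x) k x := fun x => by
    simpa using (hasDerivAt_id x).const_mul k
  refine integral_potential_mul hL hg hU hV h0 h1
    (ψ := fun x => Real.sqrt (2 / L) * (Real.cos (k * x) * k))
    (fun x => (hlin x).sin.const_mul _) (fun x => ?_) ?_ ?_
  · refine (((hlin x).cos.mul_const k).const_mul (Real.sqrt (2 / L))).congr_deriv ?_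
    rw [laplaceEigenvalue, laplaceEigenfunction, ← hk]
    ring
  · simp [laplaceEigenfunction]
  · have : Real.pi * (n + 1) / L * L = ((n + 1 : ℕ) : ℝ) * Real.pi := by
      push_cast; field_simp
    rw [laplaceEigenfunction, this, Real.sin_nat_mul_pi, mul_zero]

/-- The eigenvalues of `-Δ + g` differ from those of `-Δ` by at most `G`, from below as soon as the
basis `b` consists of eigenfunctions of the Laplacian, and the overlaps satisfy the commutator
identity. -/
lemma schrodinger_spectral_bounds (hL : 0 < L) (hg : ContinuousOn g (Icc 0 L))
    (hG : ∀ x ∈ Icc 0 L, |g x| ≤ G) (hG0 : 0 ≤ G) (hlam : Monotone lam)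
    (heb : ∀ j, SchrodingerOp L g (eb j) (-(lam j) • eb j))
    (he : ∀ j, IsContinuousRep L (eb j) (e j))
    (hb : ∀ j, D ≤ j → b j =ᵐ[intervalMeasure L] laplaceEigenfunction L j) :
    (∀ j : ℕ, lam j ≤ (Real.pi / L) ^ 2 * (j + 1) ^ 2 + G) ∧
    (∀ j : ℕ, j ≥ D → (Real.pi / L) ^ 2 * (j + 1) ^ 2 ≤ lam j + G) ∧
    ∀ j : ℕ, ∀ n : ℕ, n ≥ D → |(lam j - (Real.pi / L) ^ 2 * (n + 1) ^ 2) * ⟪eb j, b n⟫_ℝ| ≤ G := by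
  obtain ⟨M, hMG, hM⟩ := exists_mul_clm hg hG hG0
  have hbl : ∀ n ≥ D, b n = laplaceEigenvector L n := fun n hn =>
    Lp.ext ((hb n hn).trans (laplaceEigenvector_ae_eq L n).symm)
  have hcomm := fun j n => inner_mul_laplaceEigenvector hL hg hM (heb j) (he j) n
  have hsymm : ∀ u v : L2Interval L, ⟪u, M v⟫_ℝ = ⟪M u, v⟫_ℝ := fun u v => by
    rw [L2Interval.inner_eq hL EventuallyEq.rfl (hM v), L2Interval.inner_eq hL (hM u)
      EventuallyEq.rfl]
    congr 1
    ext x; ring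
  refine ⟨fun j => ?_, fun j hj => ?_, fun j n hn => ?_⟩
  · have := eigenvalue_le_add_norm eb (laplaceEigenvector_orthonormal hL) hlam
      (laplaceEigenvalue_monotone L) M j fun i _ n _ => by rw [hsymm, hcomm]
    rw [← laplaceEigenvalue_eq]
    linarith
  -- here `b` is the Hilbert basis, so that completeness of the sines is not needed
  · have := eigenvalue_le_add_norm b eb.orthonormal (laplaceEigenvalue_monotone L) hlam (-M) j
      fun i _ n hn => by
        rw [neg_apply, inner_neg_right, real_inner_comm (M (eb i)),
          real_inner_comm (eb i), hbl n (hj.trans hn), hcomm]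
        ring
    rw [norm_neg] at this
    rw [← laplaceEigenvalue_eq]
    linarith
  · rw [← laplaceEigenvalue_eq, hbl n hn, ← hcomm]
    calc _ ≤ ‖M (eb j)‖ * ‖laplaceEigenvector L n‖ := abs_real_inner_le_norm _ _
      _ ≤ ‖M‖ * ‖eb j‖ * ‖laplaceEigenvector L n‖ := by gcongr; exact M.le_opNorm _
      _ ≤ G := by
        rw [eb.orthonormal.1, (laplaceEigenvector_orthonormal hL).1]
        linarith

/-- The normalized eigenfunctions are uniformly bounded: the energy estimate covers the eigenvalues
above `1`, and only finitely many others remain. -/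
lemma exists_bound_eigenfunctions (hL : 0 < L) (hg : ContinuousOn g (Icc 0 L))
    (hG : ∀ x ∈ Icc 0 L, |g x| ≤ G)
    (hlam : Tendsto lam atTop atTop)
    (heb : ∀ j, SchrodingerOp L g (eb j) (-(lam j) • eb j))
    (he : ∀ j, IsContinuousRep L (eb j) (e j)) :
    ∃ K, ∀ j, ∀ x ∈ Icc 0 L, |e j x| ≤ K := by
  obtain ⟨N, hN⟩ := eventually_atTop.1 (hlam.eventually_ge_atTop 1)
  have hfin : ∀ j, ∃ B, ∀ x ∈ Icc 0 L, |e j x| ≤ B := fun j =>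
    isCompact_Icc.exists_bound_of_continuousOn (he j).1
  choose B hB using hfin
  have m0 : (0 : ℝ) ∈ Icc 0 L := ⟨le_rfl, hL.le⟩
  have hB0 : ∀ j, 0 ≤ B j := fun j => (abs_nonneg _).trans (hB j 0 m0)
  have hsum : 0 ≤ ∑ j ∈ Finset.range N, B j := Finset.sum_nonneg fun j _ => hB0 j
  refine ⟨∑ j ∈ Finset.range N, B j + Real.sqrt (Real.exp (G * L) * (2 + G) / L),
    fun j x hx => ?_⟩
  rcases lt_or_ge j N with h | h
  · have h1 := Finset.single_le_sum (fun j _ => hB0 j) (Finset.mem_range.2 h)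
    have := hB j x hx
    have := Real.sqrt_nonneg (Real.exp (G * L) * (2 + G) / L)
    linarith
  · obtain ⟨U, V, heU, hU, hV, h0, h1⟩ := exists_classical_solution hL hg (heb j) (he j)
    have hebU : eb j =ᵐ[intervalMeasure L] U := by
      filter_upwards [(he j).2, ae_restrict_mem measurableSet_Icc] with x hx hx'
      rw [hx, heU hx']
    have hnorm : ∫ x in (0 : ℝ)..L, U x * U x = 1 := by
      rw [← L2Interval.inner_eq hL hebU hebU, real_inner_self_eq_norm_sq, eb.orthonormal.1,
        one_pow]
    have h2 := sq_le_of_classical_solution hL hg hG (hN j h) hU hV h0 h1 hnorm hx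
    rw [heU hx]
    exact (Real.abs_le_sqrt h2).trans (le_add_of_nonneg_left hsum)

end Schrodinger

/-! ### Local averages -/

section Box

variable {L x₀ : ℝ} {u : L2Interval L} {U : ℝ → ℝ}

lemma inner_boxFunction (hU : IsContinuousRep L u U) (ε : ℝ) :
    ⟪boxFunction L x₀ ε, u⟫_ℝ =
      ε⁻¹ * ∫ x in Icc (x₀ - ε / 2) (x₀ + ε / 2) ∩ Icc 0 L, U x := by
  rw [boxFunction, L2.inner_indicatorConstLp_eq_inner_setIntegral,
    Measure.restrict_restrict measurableSet_Icc]
  have h : ∫ x in Icc (x₀ - ε / 2) (x₀ + ε / 2) ∩ Icc 0 L, u x =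
      ∫ x in Icc (x₀ - ε / 2) (x₀ + ε / 2) ∩ Icc 0 L, U x :=
    integral_congr_ae (ae_mono (Measure.restrict_mono inter_subset_right le_rfl) hU.2)
  rw [h]
  simp [mul_comm]

lemma abs_inv_mul_setIntegral_le {f : ℝ → ℝ} {s : Set ℝ} {ε K : ℝ} (hε : 0 < ε) (hK : 0 ≤ K)
    (hs : s ⊆ Icc (x₀ - ε / 2) (x₀ + ε / 2)) (hf : ∀ x ∈ s, |f x| ≤ K) :
    |ε⁻¹ * ∫ x in s, f x| ≤ K := by
  have hvol : volume s ≤ ENNReal.ofReal ε := (measure_mono hs).trans_eq (by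
    rw [Real.volume_Icc]; congr 1; ring)
  have h := norm_setIntegral_le_of_norm_le_const (f := f) (C := K)
    (hvol.trans_lt ENNReal.ofReal_lt_top) hf
  have hr : volume.real s ≤ ε := ENNReal.toReal_le_of_le_ofReal hε.le hvol
  rw [abs_mul, abs_of_pos (inv_pos.2 hε), inv_mul_le_iff₀ hε, mul_comm]
  exact h.trans (by gcongr)

lemma abs_inner_boxFunction_le (hU : IsContinuousRep L u U) {ε K : ℝ} (hε : 0 < ε) (hK : 0 ≤ K)
    (hb : ∀ x ∈ Icc 0 L, |U x| ≤ K) : |⟪boxFunction L x₀ ε, u⟫_ℝ| ≤ K := by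
  rw [inner_boxFunction hU]
  exact abs_inv_mul_setIntegral_le hε hK inter_subset_left fun x hx => hb x hx.2

lemma tendsto_inner_boxFunction (hU : IsContinuousRep L u U) (hx₀ : x₀ ∈ Ioo 0 L) :
    Tendsto (fun ε => ⟪boxFunction L x₀ ε, u⟫_ℝ) (𝓝[>] 0) (𝓝 (U x₀)) := by
  rw [Metric.tendsto_nhdsWithin_nhds]
  intro η hη
  have hc : ContinuousAt U x₀ := hU.1.continuousAt (Icc_mem_nhds hx₀.1 hx₀.2)
  obtain ⟨δ, hδ, hδU⟩ := Metric.continuousAt_iff.1 hc (η / 2) (by positivity)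
  refine ⟨min δ (min x₀ (L - x₀)), lt_min hδ (lt_min hx₀.1 (sub_pos.2 hx₀.2)),
    fun ε hε hεd => ?_⟩
  have hε0 : 0 < ε := hε
  rw [Real.dist_eq, sub_zero, abs_of_pos hε0] at hεd
  obtain ⟨hd1, hd2, hd3⟩ : ε < δ ∧ ε < x₀ ∧ ε < L - x₀ := by
    simpa [lt_min_iff] using hεd
  have hsub : Icc (x₀ - ε / 2) (x₀ + ε / 2) ⊆ Icc 0 L :=
    Icc_subset_Icc (by linarith) (by linarith)
  rw [inner_boxFunction hU, inter_eq_self_of_subset_left hsub, Real.dist_eq]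
  have hi : IntegrableOn U (Icc (x₀ - ε / 2) (x₀ + ε / 2)) :=
    (hU.1.mono hsub).integrableOn_compact isCompact_Icc
  have hconst : U x₀ = ε⁻¹ * ∫ _ in Icc (x₀ - ε / 2) (x₀ + ε / 2), U x₀ := by
    rw [setIntegral_const, Real.volume_real_Icc_of_le (by linarith), smul_eq_mul]
    field_simp
    ring
  have hlt : |ε⁻¹ * ∫ x in Icc (x₀ - ε / 2) (x₀ + ε / 2), (U x - U x₀)| ≤ η / 2 := by
    refine abs_inv_mul_setIntegral_le hε0 (by positivity) Subset.rfl fun x hx => ?_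
    refine (hδU ?_).le
    rw [Real.dist_eq, abs_lt]
    constructor <;> linarith [hx.1, hx.2]
  rw [integral_sub hi (integrable_const _), mul_sub, ← hconst] at hlt
  linarith

end Box

/-! ### The pointwise limit -/

lemma summable_div_succ_sq_of_rpow {L : ℝ} (hL : 0 < L) {q : ℕ → ℝ} (hq : ∀ n, 0 ≤ q n) {γ : ℝ}
    (hγ : -1 < γ) (h : Summable fun j => q j * laplaceEigenvalue L j ^ γ) :
    Summable fun n : ℕ => q n / ((n : ℝ) + 1) ^ 2 := by
  have hc : 0 < (Real.pi / L) ^ 2 := by positivity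
  have h0 : ∀ n, 0 < laplaceEigenvalue L n := fun n => by
    rw [laplaceEigenvalue_eq]; positivity
  refine Summable.of_nonneg_of_le (fun n => div_nonneg (hq n) (by positivity)) (fun n => ?_)
    (h.mul_left ((Real.pi / L) ^ 2 * laplaceEigenvalue L 0 ^ (-1 - γ)))
  have h1 : laplaceEigenvalue L n ^ (-1 - γ) ≤ laplaceEigenvalue L 0 ^ (-1 - γ) :=
    Real.rpow_le_rpow_of_nonpos (h0 0) (laplaceEigenvalue_monotone L n.zero_le) (by linarith)
  have h2 : laplaceEigenvalue L n ^ γ * laplaceEigenvalue L n ^ (-1 - γ) =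
      (laplaceEigenvalue L n)⁻¹ := by
    rw [← Real.rpow_add (h0 n), ← Real.rpow_neg_one]; ring_nf
  calc q n / ((n : ℝ) + 1) ^ 2 = (Real.pi / L) ^ 2 * (q n * (laplaceEigenvalue L n)⁻¹) := by
        rw [laplaceEigenvalue_eq]; field_simp
    _ = (Real.pi / L) ^ 2 * (q n *
        (laplaceEigenvalue L n ^ γ * laplaceEigenvalue L n ^ (-1 - γ))) := by rw [h2]
    _ ≤ (Real.pi / L) ^ 2 * (q n *
        (laplaceEigenvalue L n ^ γ * laplaceEigenvalue L 0 ^ (-1 - γ))) := by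
        have := hq n
        have := Real.rpow_nonneg (h0 n).le γ
        gcongr
    _ = _ := by ring

theorem mainTheorem5
    (L : ℝ) (hL : 0 < L)
    -- the potential `g`: uniformly Hölder of order `1/2 < r ≤ 1`, positive almost everywhere
    (g : ℝ → ℝ) (C r : ℝ≥0) (hr : 1 / 2 < r) (hr1 : r ≤ 1)
    (hg : HolderOnWith C r g (Icc 0 L))
    (hgpos : ∀ᵐ x ∂(intervalMeasure L), 0 < g x)
    -- orthonormal basis of eigenfunctions of `A = Δ - g`, `A e_j = -λ_j e_j`, with `λ_1 ≤ λ_2 ≤ …`;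
    -- `e j` is the continuous representative of the eigenfunction `eb j`
    (lam : ℕ → ℝ) (hlam : Monotone lam)
    (eb : HilbertBasis ℕ ℝ (L2Interval L))
    (heb : ∀ j, SchrodingerOp L g (eb j) (-(lam j) • eb j))
    (e : ℕ → ℝ → ℝ) (he : ∀ j, IsContinuousRep L (eb j) (e j))
    -- the bounded operator `Q` with its eigenvalues and orthonormal basis of eigenfunctions
    (Q : L2Interval L →L[ℝ] L2Interval L)
    (q : ℕ → ℝ) (b : HilbertBasis ℕ ℝ (L2Interval L))
    (hQ : ∀ j, Q (b j) = q j • b j)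
    (hq : ∀ j, 0 < q j)
    (hb : ∃ D : ℕ, ∀ j, D ≤ j → b j =ᵐ[intervalMeasure L] laplaceEigenfunction L j)
    (hqsum : ∃ γ : ℝ, -1 < γ ∧ Summable fun j => q j * laplaceEigenvalue L j ^ γ)
    -- the parameters, and the semigroup generated by `A_α = A + α`
    (σ α : ℝ) (hσ : 0 < σ) (hα : α < lam 0)
    (S : ℝ → L2Interval L →L[ℝ] L2Interval L)
    (hS : IsC0ContractionSemigroup S)
    (hgen : IsInfinitesimalGenerator S (ShiftedSchrodingerOp L g α)) :
    (∀ (f : L2Interval L) (t : ℝ), 0 ≤ t →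
      IntervalIntegrable (covarianceIntegrand S Q f) volume 0 t) ∧
    ∃ Vinf : L2Interval L →L[ℝ] L2Interval L,
      (∀ f, Tendsto (fun t => covarianceOp S Q σ t f) atTop (𝓝 (Vinf f))) ∧
      (∀ j₁ j₂, Summable fun n => q n * ⟪eb j₁, b n⟫_ℝ * ⟪eb j₂, b n⟫_ℝ) ∧
      ∀ x₀ ∈ Ioo 0 L,
        (Summable fun p : ℕ × ℕ => pointwiseTerm L α lam q e eb b x₀ p.1 p.2) ∧
        Tendsto (fun ε => ⟪Vinf (boxFunction L x₀ ε), boxFunction L x₀ ε⟫_ℝ) (𝓝[>] 0)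
          (𝓝 (σ ^ 2 * ∑' j₁, ∑' j₂, pointwiseTerm L α lam q e eb b x₀ j₁ j₂)) := by
  obtain ⟨D, hb⟩ := hb
  obtain ⟨γ, hγ, hqsum⟩ := hqsum
  have hgc : ContinuousOn g (Icc 0 L) := hg.continuousOn (lt_of_le_of_lt (by positivity) hr)
  obtain ⟨G, hG⟩ := isCompact_Icc.exists_bound_of_continuousOn hgc
  have hG0 : 0 ≤ G := (norm_nonneg _).trans (hG 0 ⟨le_rfl, hL.le⟩)
  have hc : 0 < (Real.pi / L) ^ 2 := by positivity
  -- spectral asymptotics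
  obtain ⟨h1, h2, h3⟩ := schrodinger_spectral_bounds hL hgc hG hG0 hlam heb he hb
  obtain ⟨k, hk, hkμ⟩ := exists_mul_sq_le_sub hc hlam hα h2
  have hlam_top : Tendsto lam atTop atTop := by
    have h4 : Tendsto (fun n : ℕ => k * (n : ℝ) + α) atTop atTop :=
      tendsto_atTop_add_const_right _ _ (tendsto_natCast_atTop_atTop.const_mul_atTop hk)
    refine tendsto_atTop_mono (fun n => ?_) h4
    have h5 : k * (n : ℝ) ≤ k * ((n : ℝ) + 1) ^ 2 := by
      have : (0 : ℝ) ≤ n := n.cast_nonneg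
      gcongr
      nlinarith
    linarith [hkμ n]
  obtain ⟨K, hK⟩ := exists_bound_eigenfunctions hL hgc hG hlam_top heb he
  have hK0 : 0 ≤ K := (abs_nonneg _).trans (hK 0 0 ⟨le_rfl, hL.le⟩)
  -- the semigroup is diagonal in the basis of eigenfunctions
  have hdiag : ∀ t, 0 ≤ t → ∀ n, S t (eb n) = Real.exp (-(lam n - α) * t) • eb n :=
    fun t ht n => semigroup_apply_eigenvector hS hgen ⟨_, heb n, by module⟩ ht
  have hμ : Monotone fun n => lam n - α := fun m n h => sub_le_sub_right (hlam h) α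
  obtain ⟨V, hV, hVm⟩ := exists_limit_covarianceOp hS Q hdiag hμ (sub_pos.2 hα) σ
  have hQs := fun i j => hasSum_inner_diagonal b hQ (eb i) (eb j)
  -- absolute convergence of the double series
  have ha1 : ∀ j n, |⟪eb j, b n⟫_ℝ| ≤ 1 := fun j n => by
    simpa [eb.orthonormal.1, b.orthonormal.1] using abs_real_inner_le_norm (eb j) (b n)
  have ha2 : ∀ n, Summable fun j => ⟪eb j, b n⟫_ℝ ^ 2 := fun n => by
    refine (eb.hasSum_inner_mul_inner (b n) (b n)).summable.congr fun j => ?_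
    rw [real_inner_comm (eb j) (b n), pow_two]
  obtain ⟨N, hN⟩ := exists_overlap_le (a := fun j n => ⟪eb j, b n⟫_ℝ) hc h1 h2 h3
  obtain ⟨C', hC', hA⟩ := exists_tsum_overlap_le (a := fun j n => ⟪eb j, b n⟫_ℝ)
    (div_nonneg (mul_nonneg zero_le_two hG0) hc.le) ha1 ha2 hN
  have habs := summable_abs_tsum_div (a := fun j n => ⟪eb j, b n⟫_ℝ) (μ := fun n => lam n - α)
    (fun n => (hq n).le) (summable_div_succ_sq_of_rpow hL (fun n => (hq n).le) hγ hqsum)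
    hk hkμ ha2 hC' hA fun i j => (hQs i j).summable.abs
  have hVeq : ∀ p : ℕ × ℕ, ⟪eb p.1, V (eb p.2)⟫_ℝ =
      σ ^ 2 * ((∑' n, q n * ⟪eb p.1, b n⟫_ℝ * ⟪eb p.2, b n⟫_ℝ) /
        (lam p.1 - α + (lam p.2 - α))) := fun p => by
    rw [hVm, (hQs p.1 p.2).tsum_eq]
  have hVs : Summable fun p : ℕ × ℕ => |⟪eb p.1, V (eb p.2)⟫_ℝ| := by
    refine (habs.mul_left (σ ^ 2)).congr fun p => ?_
    rw [hVeq, abs_mul, abs_of_nonneg (sq_nonneg σ)]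
  have hterm : ∀ x₀, ∀ p : ℕ × ℕ, σ ^ 2 * pointwiseTerm L α lam q e eb b x₀ p.1 p.2 =
      e p.1 x₀ * e p.2 x₀ * ⟪eb p.1, V (eb p.2)⟫_ℝ := fun x₀ p => by
    have hden : lam p.1 - α + (lam p.2 - α) = lam p.1 + lam p.2 - 2 * α := by ring
    rw [hVeq, pointwiseTerm, hden]
    ring
  refine ⟨fun f t ht => ?_, V, hV, fun i j => (hQs i j).summable, fun x₀ hx₀ => ?_⟩
  · refine ContinuousOn.intervalIntegrable ((continuousOn_covarianceIntegrand hS Q hdiag f).mono ?_)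
    rw [uIcc_of_le ht]
    exact Icc_subset_Ici_self
  have hx₀' : x₀ ∈ Icc 0 L := Ioo_subset_Icc_self hx₀
  have hsum : Summable fun p : ℕ × ℕ => pointwiseTerm L α lam q e eb b x₀ p.1 p.2 := by
    rw [← summable_mul_left_iff (pow_pos hσ 2).ne']
    simp only [hterm]
    refine Summable.of_norm_bounded (hVs.mul_left (K * K)) fun p => ?_
    rw [Real.norm_eq_abs, abs_mul, abs_mul]
    gcongr
    · exact hK _ _ hx₀'
    · exact hK _ _ hx₀'
  refine ⟨hsum, ?_⟩
  have hlim := tendsto_inner_apply_self (l := 𝓝[>] (0 : ℝ)) eb V hVs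
    (f := fun ε => boxFunction L x₀ ε) (K := K)
    (fun n => tendsto_inner_boxFunction (he n) hx₀) (by
      filter_upwards [self_mem_nhdsWithin] with ε hε n
      exact abs_inner_boxFunction_le (he n) hε hK0 (hK n))
  simp only [← hterm] at hlim
  rw [tsum_mul_left, hsum.tsum_prod] at hlim
  exact hlim
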